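/- **Model.** Let $n\ge 2$, $d\in\{1,\dots,n-1\}$ and $k\ge1$ be integers. In a discrete-time system of $n$ single-server queues with infinite buffers, the pairs $(A(t),\mathbf S(t))\in\mathbb Z_+\times\mathbb Z_+^n$, $t\ge0$, of numbers of arrivals and of potential services are i.i.d. over time and independent of the state of the system at time $t$. They are almost surely bounded, $A(t)\le nA_{\max}$ and $S_i(t)\le S_{\max}$, with $\mathbb E[A(t)]=n\lambda$ and $\mathbb E[S_i(t)]=\mu_i>0$ for all $i$. All jobs that arrive in slot $t$ are sent to one queue $I_R(t)$, and $Q_i(t+1)=[Q_i(t)+A(t)\mathbf 1\{i=I_R(t)\}-S_i(t)]^+$. Under the policy $k$-SLQ-$d$, at each time $t$ that is a multiple of $k(n-d)$ the queue lengths are sampled and a set of $d$ longest queues is selected (ties are broken uniformly at random). During the $k(n-d)$ slots that start at this time, the arrivals are sent in a round-robin fashion, in $k$ rounds, each in increasing order of the indices, to the $n-d$ queues outside the selected set. Let $I_d(t)$ be the set selected at the last sampling time and $N_R(t)\in\{0,\dots,k-1\}$ the number of rounds completed since then. Then $\mathbf X(t)=(\mathbf Q(t),I_d(t),I_R(t),N_R(t))$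 is a Markov chain. Its state space is taken to be the set of states that the system started with empty queues at a sampling time can visit. A state is positive recurrent if its mean return time is finite, and the chain is positive recurrent if all states of the state space are. **Theorem.** Put $$\theta=\min_{I\subseteq[n],\,|I|\ge d+1}\ \frac{n-d}{|I|-d}\sum_{l\in I}\mu_l .$$ 1. Suppose that $\mathbf X(t)$ is irreducible on its state space. Then $\mathbf X(t)$ is positive recurrent if and only if $n\lambda<\theta$. 2. If $\mathbf X(t)$ is not assumed irreducible, one still has: if $n\lambda<\theta$, then from every initial state $(\mathbf q,J,i,r)$ with $\mathbf q\in\mathbb Z_+^n$, $|J|=d$, $i\notin J$, $0\le r<k$, the chain enters the set of positive recurrent states in finite mean time; if $n\lambda>\theta$, then no such state is positive recurrent. In particular the stability region does not depend on $k$: if the chains for $k$ and for $k'$ are both irreducible, then one is positive recurrent if and only if the other is. -/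

import Mathlib

open scoped ENNReal

noncomputable section

/-! ## Discrete-time Markov chains given by a transition function -/

namespace MarkovChain

variable {α : Type*}

/-- `y` can be reached from `x` with positive probability in some number of steps (possibly `0`). -/
def LeadsTo (P : α → PMF α) : α → α → Prop :=
  Relation.ReflTransGen (fun x y => y ∈ (P x).support)

/-- The states that the chain visits with positive probability when it is started in `init`. -/
def reachable (P : α → PMF α) (init : Set α) : Set α :=
  {y | ∃ x ∈ init, LeadsTo P x y}

/-- The chain is irreducible on the state space `C`: any two states communicate. -/
def IrreducibleOn (P : α → PMF α) (C : Set α) : Prop :=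
  ∀ x ∈ C, ∀ y ∈ C, LeadsTo P x y

/-- `notHit P T m x` is the probability, for the chain `X 0 = x, X 1, X 2, …`, that none of
`X 1, …, X m` lies in `T`. With `τ = inf {m ≥ 1 | X m ∈ T}` this is the probability of `τ > m`. -/
def notHit (P : α → PMF α) (T : Set α) : ℕ → α → ℝ≥0∞
  | 0, _ => 1
  | m + 1, x => ∑' y, P x y * Tᶜ.indicator (notHit P T m) y

/-- The expectation `E_x[τ] = ∑_{m ≥ 0} P_x(τ > m)` of the first time `τ ≥ 1` at which the chain
started in `x` is in `T` (it is `∞` if `τ = ∞` has positive probability). -/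
def meanHittingTime (P : α → PMF α) (T : Set α) (x : α) : ℝ≥0∞ :=
  ∑' m, notHit P T m x

/-- A state is positive recurrent if its mean return time is finite. -/
def PositiveRecurrentState (P : α → PMF α) (x : α) : Prop :=
  meanHittingTime P {x} x < ∞

/-- The chain with state space `C` is positive recurrent: every state is. -/
def PositiveRecurrentOn (P : α → PMF α) (C : Set α) : Prop :=
  ∀ x ∈ C, PositiveRecurrentState P x

end MarkovChain

/-! ## The parallel queueing system under the `k`-SLQ-`d` policy -/

namespace SLQ

/-- The sets of `d` queues out of `n`. -/
abbrev Skip (n d : ℕ) : Type := {J : Finset (Fin n) // J.card = d}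

/-- The sets of `d` longest queues for the queue length vector `Q`; there are several such sets
exactly when there are ties. -/
def longest {n : ℕ} (d : ℕ) (Q : Fin n → ℕ) : Finset (Skip n d) :=
  Finset.univ.filter fun J => ∀ i ∈ J.1, ∀ j ∉ J.1, Q j ≤ Q i

theorem longest_nonempty {n d : ℕ} (hd : d ≤ n) (Q : Fin n → ℕ) : (longest d Q).Nonempty := by
  induction d with
  | zero => exact ⟨⟨∅, rfl⟩, by simp [longest]⟩
  | succ d ih =>
    obtain ⟨⟨J, hJ⟩, hmem⟩ := ih (by omega)
    have hmax : ∀ i ∈ J, ∀ j ∉ J, Q j ≤ Q i := by simpa [longest] using hmem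
    have hne : Jᶜ.Nonempty := by
      rw [← Finset.card_pos, Finset.card_compl, Fintype.card_fin]
      omega
    obtain ⟨m, hm, hmm⟩ := Finset.exists_max_image Jᶜ Q hne
    have hm' : m ∉ J := Finset.mem_compl.1 hm
    refine ⟨⟨insert m J, by rw [Finset.card_insert_of_notMem hm', hJ]⟩, ?_⟩
    simp only [longest, Finset.mem_filter, Finset.mem_univ, true_and, Finset.mem_insert, not_or]
    rintro i (rfl | hi) j ⟨_, hj⟩
    · exact hmm j (Finset.mem_compl.2 hj)
    · exact hmax i hi j hj

theorem compl_nonempty {n d : ℕ} (hd : d < n) (J : Skip n d) : (J.1ᶜ).Nonempty := by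
  rw [← Finset.card_pos, Finset.card_compl, Fintype.card_fin, J.2]
  omega

/-- The states `(Q, I_d, I_R, N_R)` of the chain. -/
structure State (n d k : ℕ) where
  /-- the queue lengths -/
  Q : Fin n → ℕ
  /-- the `d` queues that were found longest when the queue lengths were last sampled -/
  skip : Skip n d
  /-- the queue to which the arrivals of the current time slot are sent -/
  cur : Fin n
  cur_notMem : cur ∉ skip.1
  /-- the number of round-robin rounds completed since the queue lengths were last sampled -/
  round : Fin k

variable {n d k : ℕ}

/-- The state in a sampling slot with queue lengths `Q` and chosen set `J` of longest queues. -/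
def start (hd : d < n) (hk : 0 < k) (Q : Fin n → ℕ) (J : Skip n d) : State n d k where
  Q := Q
  skip := J
  cur := (J.1ᶜ).min' (compl_nonempty hd J)
  cur_notMem := Finset.mem_compl.1 (Finset.min'_mem _ _)
  round := ⟨0, hk⟩

/-- The queues outside the skipped set that come after the current one in the present round. -/
def State.later (s : State n d k) : Finset (Fin n) :=
  s.skip.1ᶜ.filter fun i => s.cur < i

/-- The queue lengths at the beginning of the next slot, `[Q + a Y - σ]⁺`, when `a` jobs arrive and
the potential services are `σ` (the subtraction of natural numbers is truncated at `0`). -/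
def State.nextQ (s : State n d k) (a : ℕ) (σ : Fin n → ℕ) : Fin n → ℕ :=
  fun i => s.Q i + (if i = s.cur then a else 0) - σ i

/-- The state at the beginning of the next slot, given the queue lengths `Q'` then. Round-robin
goes through the non-skipped queues in increasing order. After `k` rounds, that is `k * (n - d)`
slots, the queue lengths are sampled and a set of `d` longest queues is drawn, uniformly at random
among all such sets. -/
def next (hd : d < n) (hk : 0 < k) (s : State n d k) (Q' : Fin n → ℕ) : PMF (State n d k) :=
  if h : s.later.Nonempty then
    PMF.pure
      { Q := Q'
        skip := s.skip
        cur := s.later.min' h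
        cur_notMem :=
          Finset.mem_compl.1 (Finset.mem_filter.1 (Finset.min'_mem s.later h)).1
        round := s.round }
  else if h' : s.round.1 + 1 < k then
    PMF.pure
      { Q := Q'
        skip := s.skip
        cur := (s.skip.1ᶜ).min' (compl_nonempty hd s.skip)
        cur_notMem := Finset.mem_compl.1 (Finset.min'_mem _ _)
        round := ⟨s.round.1 + 1, h'⟩ }
  else
    (PMF.uniformOfFinset (longest d Q') (longest_nonempty hd.le Q')).map (start hd hk Q')

/-- The transition law of the chain, where `ρ` is the joint law of the number `A(t)` of arrivals
and the vector `S(t)` of potential services in one slot; these pairs are i.i.d. over time. -/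
def step (hd : d < n) (hk : 0 < k) (ρ : PMF (ℕ × (Fin n → ℕ))) (s : State n d k) :
    PMF (State n d k) :=
  ρ.bind fun p => next hd hk s (s.nextQ p.1 p.2)

/-- The possible states at time `0` of the system started with empty queues. -/
def emptyStates (hd : d < n) (hk : 0 < k) : Set (State n d k) :=
  Set.range (start hd hk 0)

/-- The state space: all states that the system, started with empty queues, can visit. -/
def stateSpace (hd : d < n) (hk : 0 < k) (ρ : PMF (ℕ × (Fin n → ℕ))) : Set (State n d k) :=
  MarkovChain.reachable (step hd hk ρ) (emptyStates hd hk)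

/-- The expectation of `f` under the discrete law `p`. -/
def mean {β : Type*} (p : PMF β) (f : β → ℝ) : ℝ :=
  ∑' x, (p x).toReal * f x

/-- `min { (n - d) / (|I| - d) * ∑_{l ∈ I} μ_l : I ⊆ [n], |I| ≥ d + 1 }`. -/
def threshold (hd : d < n) (μ : Fin n → ℝ) : ℝ :=
  (Finset.univ.filter fun I : Finset (Fin n) => d + 1 ≤ I.card).inf'
    ⟨Finset.univ, by simpa using hd⟩
    fun I => ((n : ℝ) - d) / ((I.card : ℝ) - d) * ∑ l ∈ I, μ l

end SLQ

end

/-! Let Λ = nλ, and let `s.rem i` count the slots of the current cycle still assigned to queue `i`.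

Below the threshold, add to each queue length the mean net work `corr` that it is to receive before
the next sampling. Between samplings this corrected vector is a martingale up to unused service, so
its squared length gains only a bounded amount per slot, which a multiple of the remaining time pays
for. At a sampling with new skipped set `J`, the square gains twice `∑ Q i * k * (Λ * 1{i ∉ J} - (n
- d) * μ i)`, up to a constant. Cut `Q` into its upper level sets `I`. Since `J` consists of longest
queues, `|I \ J|` is exactly the positive part of `|I| - d`, so the threshold condition makes every
level contribute negatively (`sum_notMem_longest_le`). This gives the drift bound `lyapunov_le`.
Foster-Lyapunov then leads to a finite set, and a minimal set of mutually reachable points in it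
yields positive recurrent states.

At or above the threshold, take a set `I` that violates the condition. Whatever `J` is, at least
`|I| - d` queues of `I` are served by round-robin, so `excess` is a submartingale whose upward jumps
are bounded. A strict mean increase at the initial state forces `P(τ > m) ≥ c / m` for the return
time, hence an infinite mean (`not_positiveRecurrentState_of_drift`). At equality the strictness
comes from service wasted on an empty skipped queue. -/

namespace MarkovChain

/-! ### Hitting times and their first-step equations. -/

variable {α : Type*} {P : α → PMF α} {T D C : Set α}

/-- The transition operator of the chain killed on entering `T`. -/
noncomputable def killed (P : α → PMF α) (T : Set α) (f : α → ℝ≥0∞) (x : α) : ℝ≥0∞ :=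
  ∑' y, P x y * Tᶜ.indicator f y

/-- The expectation of `min τ m`, where `τ` is the hitting time of `T`. -/
noncomputable def truncHit (P : α → PMF α) (T : Set α) (m : ℕ) (x : α) : ℝ≥0∞ :=
  ∑ j ∈ Finset.range m, notHit P T j x

theorem tsum_mul_le_of_support {p : PMF α} {f g : α → ℝ≥0∞} (h : ∀ y ∈ p.support, f y ≤ g y) :
    ∑' y, p y * f y ≤ ∑' y, p y * g y := by
  refine ENNReal.tsum_le_tsum fun y => ?_
  by_cases hy : p y = 0
  · simp [hy]
  · gcongr
    exact h y ((PMF.mem_support_iff _ _).2 hy)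

theorem tsum_mul_add_const (p : PMF α) (f : α → ℝ≥0∞) (M : ℝ≥0∞) :
    ∑' y, p y * (f y + M) = ∑' y, p y * f y + M := by
  simp only [mul_add, ENNReal.tsum_add, ENNReal.tsum_mul_right, PMF.tsum_coe, one_mul]

theorem notHit_succ (m : ℕ) (x : α) : notHit P T (m + 1) x = killed P T (notHit P T m) x := rfl

theorem killed_mono {f g : α → ℝ≥0∞} {x : α} (h : ∀ y ∈ (P x).support, y ∉ T → f y ≤ g y) :
    killed P T f x ≤ killed P T g x := by
  refine tsum_mul_le_of_support fun y hy => ?_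
  by_cases hT : y ∈ T
  · simp [hT]
  · simpa [hT] using h y hy hT

theorem killed_le (f : α → ℝ≥0∞) (x : α) : killed P T f x ≤ ∑' y, P x y * f y :=
  tsum_mul_le_of_support fun y _ => Set.indicator_le_self _ _ y

theorem killed_add (f g : α → ℝ≥0∞) (x : α) :
    killed P T (fun y => f y + g y) x = killed P T f x + killed P T g x := by
  simp only [killed, ← ENNReal.tsum_add, ← mul_add]
  refine tsum_congr fun y => ?_
  by_cases hT : y ∈ T <;> simp [hT]

theorem killed_mul_const (f : α → ℝ≥0∞) (c : ℝ≥0∞) (x : α) :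
    killed P T (fun y => f y * c) x = killed P T f x * c := by
  simp only [killed, ← ENNReal.tsum_mul_right]
  refine tsum_congr fun y => ?_
  by_cases hT : y ∈ T <;> simp [hT, mul_assoc]

theorem killed_const_le (c : ℝ≥0∞) (x : α) : killed P T (fun _ => c) x ≤ c :=
  (killed_le _ _).trans (by simp [ENNReal.tsum_mul_right])

theorem notHit_le_one (m : ℕ) (x : α) : notHit P T m x ≤ 1 := by
  induction m generalizing x with
  | zero => exact le_rfl
  | succ m ih => exact (killed_mono fun y _ _ => ih y).trans (killed_const_le 1 x)

theorem notHit_antitone (x : α) : Antitone fun m => notHit P T m x := by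
  refine antitone_nat_of_succ_le fun m => ?_
  induction m generalizing x with
  | zero => exact notHit_le_one 1 x
  | succ m ih => exact killed_mono fun y _ _ => ih y

theorem truncHit_succ (m : ℕ) (x : α) :
    truncHit P T (m + 1) x = 1 + killed P T (truncHit P T m) x := by
  induction m with
  | zero =>
    have h : ∀ y, Tᶜ.indicator (truncHit P T 0) y = 0 := fun y => by
      by_cases hy : y ∈ T <;> simp [hy, truncHit]
    simp only [killed, h]
    simp [truncHit, notHit]
  | succ m ih =>
    have h : killed P T (truncHit P T (m + 1)) x
        = killed P T (truncHit P T m) x + killed P T (notHit P T m) x := by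
      rw [← killed_add]
      refine congrArg (fun f => killed P T f x) (funext fun y => ?_)
      exact Finset.sum_range_succ _ _
    rw [h, ← add_assoc, ← ih, ← notHit_succ]
    exact Finset.sum_range_succ _ _

theorem truncHit_mono (x : α) : Monotone fun m => truncHit P T m x := fun _ _ h =>
  Finset.sum_le_sum_of_subset (Finset.range_mono h)

theorem truncHit_le (m : ℕ) (x : α) : truncHit P T m x ≤ m := by
  refine (Finset.sum_le_card_nsmul (Finset.range m) _ 1 fun j _ => notHit_le_one j x).trans ?_
  simp

theorem meanHittingTime_le {x : α} {u : ℝ≥0∞} (h : ∀ m, truncHit P T m x ≤ u) :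
    meanHittingTime P T x ≤ u :=
  ENNReal.tsum_le_of_sum_range_le h

theorem truncHit_le_meanHittingTime (m : ℕ) (x : α) :
    truncHit P T m x ≤ meanHittingTime P T x :=
  ENNReal.sum_le_tsum _

theorem meanHittingTime_eq (x : α) :
    meanHittingTime P T x = 1 + killed P T (meanHittingTime P T) x := by
  have h : killed P T (meanHittingTime P T) x = ∑' m, notHit P T (m + 1) x := by
    simp only [notHit_succ, killed]
    rw [ENNReal.tsum_comm]
    refine tsum_congr fun y => ?_
    rw [ENNReal.tsum_mul_left]
    by_cases hT : y ∈ T <;> simp [hT, meanHittingTime]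
  rw [h, meanHittingTime, tsum_eq_zero_add' ENNReal.summable]
  rfl

theorem meanHittingTime_le_of_superharmonic {u : α → ℝ≥0∞} (h : ∀ x, 1 + killed P T u x ≤ u x)
    (x : α) : meanHittingTime P T x ≤ u x := by
  refine meanHittingTime_le fun m => ?_
  induction m generalizing x with
  | zero => simp [truncHit]
  | succ m ih =>
    rw [truncHit_succ]
    exact (add_le_add_right (killed_mono fun y _ _ => ih y) 1).trans (h x)

/-! ### The Foster-Lyapunov criterion. -/

/-- The Foster-Lyapunov criterion. -/
theorem meanHittingTime_lt_top_of_drift {V : α → ℝ≥0∞} (hV : ∀ x, V x ≠ ∞) {E : ℝ≥0∞}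
    (hE : E ≠ ∞) (h : ∀ x ∉ C, ∑' y, P x y * V y + 1 ≤ V x)
    (hC : ∀ x ∈ C, ∑' y, P x y * V y + 1 ≤ V x + E) (x : α) :
    meanHittingTime P C x < ∞ := by
  -- The surcharge `E` matters only for a start in `C`: the killed operator never sees it again.
  have key := meanHittingTime_le_of_superharmonic (P := P) (T := C)
    (u := fun x => V x + C.indicator (fun _ => E) x) (fun x => ?_) x
  · refine key.trans_lt (ENNReal.add_lt_top.2 ⟨(hV x).lt_top, ?_⟩)
    by_cases hx : x ∈ C <;> simp [hx, hE.lt_top]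
  · have h1 : killed P C (fun x => V x + C.indicator (fun _ => E) x) x ≤ ∑' y, P x y * V y :=
      (killed_mono (g := V) fun y _ hy => by simp [hy]).trans (killed_le _ _)
    by_cases hx : x ∈ C
    · simpa [hx, add_comm] using (add_le_add_right h1 1).trans (by simpa [add_comm] using hC x hx)
    · simpa [hx, add_comm] using (add_le_add_right h1 1).trans (by simpa [add_comm] using h x hx)

/-! ### Passing from a finite set to a target. -/

/-- To reach `T`, wait for `D` and restart there. The truncated form keeps `M` finite when it is a
maximum of the quantities to be bounded. -/
theorem truncHit_le_add {M : ℝ≥0∞} {m : ℕ} (hM : ∀ c ∈ D, truncHit P T m c ≤ M) (x : α) :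
    truncHit P T m x ≤ meanHittingTime P D x + M := by
  have key : ∀ j ≤ m, ∀ x, truncHit P T j x ≤ meanHittingTime P D x + M := by
    intro j
    induction j with
    | zero => simp [truncHit]
    | succ j ih =>
      intro hj x
      rw [truncHit_succ, meanHittingTime_eq, add_assoc, killed, killed, ← tsum_mul_add_const]
      gcongr with y
      refine (Set.indicator_le_self _ _ y).trans ?_
      by_cases hy : y ∈ D
      · simpa [hy] using (truncHit_mono y (by omega : j ≤ m)).trans (hM y hy)
      · simpa [hy] using ih (by omega) y
  exact key m le_rfl x

theorem meanHittingTime_le_add {M : ℝ≥0∞} (hM : ∀ c ∈ D, meanHittingTime P T c ≤ M) (x : α) :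
    meanHittingTime P T x ≤ meanHittingTime P D x + M :=
  meanHittingTime_le fun m =>
    truncHit_le_add (fun c hc => (truncHit_le_meanHittingTime m c).trans (hM c hc)) x

/-- Run `N` steps; only the paths that missed `T` go on, by returning to `D` and restarting. Each
step raises the mean time to `D` by at most `K`. When the survival probability on `D` is below 1,
this becomes a contraction for the maximum over `D`. -/
theorem truncHit_add_le {K M : ℝ≥0∞} {m : ℕ} (hK : ∀ c ∈ D, meanHittingTime P D c ≤ K)
    (hM : ∀ c ∈ D, truncHit P T m c ≤ M) (N : ℕ) (x : α) :
    truncHit P T (N + m) x ≤ meanHittingTime P D x + N * (1 + K) + notHit P T N x * M := by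
  induction N generalizing x with
  | zero => simpa [notHit] using truncHit_le_add hM x
  | succ N ih =>
    have h1 : killed P T (meanHittingTime P D) x ≤ meanHittingTime P D x + K := by
      refine (killed_le _ _).trans ?_
      rw [meanHittingTime_eq x, add_assoc]
      refine le_add_left ?_
      rw [killed, ← tsum_mul_add_const]
      gcongr with y
      by_cases hy : y ∈ D
      · simpa [hy] using hK y hy
      · simp [hy]
    rw [Nat.add_right_comm, truncHit_succ]
    calc 1 + killed P T (truncHit P T (N + m)) x
        ≤ 1 + killed P T (fun y => meanHittingTime P D y + N * (1 + K) + notHit P T N y * M) x := by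
          gcongr
          exact killed_mono fun y _ _ => ih y
      _ ≤ 1 + ((meanHittingTime P D x + K) + N * (1 + K) + notHit P T (N + 1) x * M) := by
          rw [killed_add, killed_add, notHit_succ]
          gcongr
          · exact killed_const_le _ x
          · exact (killed_mul_const _ _ _).le
      _ = _ := by push_cast; ring

theorem notHit_lt_one_of_transGen {x y : α}
    (h : Relation.TransGen (fun x y => y ∈ (P x).support) x y) (hy : y ∈ T) :
    ∃ m, notHit P T m x < 1 := by
  have step : ∀ {x z : α} {m : ℕ}, z ∈ (P x).support → Tᶜ.indicator (notHit P T m) z < 1 →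
      notHit P T (m + 1) x < 1 := by
    intro x z m hz hlt
    have h1 : ∀ w, Tᶜ.indicator (notHit P T m) w ≤ 1 := fun w =>
      (Set.indicator_le_self _ _ w).trans (notHit_le_one m w)
    rw [← (P x).tsum_coe]
    refine ENNReal.tsum_lt_tsum (i := z) ?_ (fun w => mul_le_of_le_one_right' (h1 w)) ?_
    · exact ne_top_of_le_ne_top ENNReal.one_ne_top (notHit_le_one (P := P) (T := T) (m + 1) x)
    · calc P x z * Tᶜ.indicator (notHit P T m) z < P x z * 1 := by
            refine (ENNReal.mul_lt_mul_iff_right ?_ ((P x).apply_ne_top z)).2 hlt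
            exact (PMF.mem_support_iff _ _).1 hz
        _ = _ := mul_one _
  induction h using Relation.TransGen.head_induction_on with
  | single h => exact ⟨1, step (m := 0) h (by simp [hy])⟩
  | head h _ ih =>
    obtain ⟨m, hm⟩ := ih
    exact ⟨m + 1, step h ((Set.indicator_le_self _ _ _).trans_lt hm)⟩

theorem exists_transGen_of_meanHittingTime_lt_top {x : α} (h : meanHittingTime P T x < ∞) :
    ∃ y ∈ T, Relation.TransGen (fun x y => y ∈ (P x).support) x y := by
  by_contra! hcon
  have key : ∀ m z, (∀ y ∈ T, ¬ Relation.TransGen (fun x y => y ∈ (P x).support) z y) →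
      notHit P T m z = 1 := by
    intro m
    induction m with
    | zero => intros; rfl
    | succ m ih =>
      intro z hz
      refine (tsum_congr fun y => ?_).trans (P z).tsum_coe
      by_cases hy : P z y = 0
      · simp [hy]
      · have hy' : y ∈ (P z).support := (PMF.mem_support_iff _ _).2 hy
        have hT : y ∉ T := fun hT => hz y hT (.single hy')
        simp [hT, ih y fun w hw hyw => hz w hw (.head hy' hyw)]
  have : meanHittingTime P T x = ∞ := by
    simp [meanHittingTime, key _ x hcon]
  exact h.ne this

/-- Finiteness of `M` is essential, since `M = ∞` satisfies the inequality whenever `q ≠ 0`. -/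
theorem _root_.ENNReal.le_div_of_le_add_mul {M B q : ℝ≥0∞} (hM : M ≠ ∞) (hq : q < 1)
    (h : M ≤ B + q * M) : M ≤ B / (1 - q) := by
  have h1 : (1 - q) ≠ 0 := (tsub_pos_of_lt hq).ne'
  have h2 : (1 - q) ≠ ∞ := ne_top_of_le_ne_top ENNReal.one_ne_top tsub_le_self
  rw [ENNReal.le_div_iff_mul_le (.inl h1) (.inl h2), mul_comm,
    ENNReal.sub_mul fun _ _ => hM, one_mul]
  exact tsub_le_iff_right.2 h

/-- If the chain returns to the finite set `D` in finite mean time and can go from each point of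
`D` to `T`, then it enters `T` in finite mean time. -/
theorem meanHittingTime_lt_top_of_finite (hD : D.Finite)
    (hfin : ∀ c ∈ D, meanHittingTime P D c < ∞)
    (hT : ∀ c ∈ D, ∃ y ∈ T, Relation.TransGen (fun x y => y ∈ (P x).support) c y) :
    ∀ c ∈ D, meanHittingTime P T c < ∞ := by
  have h1 : ∀ c : D, ∃ m, notHit P T m c < 1 := fun c => by
    obtain ⟨y, hy, hcy⟩ := hT c c.2
    exact notHit_lt_one_of_transGen hcy hy
  choose m hm using h1
  have : Fintype D := hD.fintype
  -- A common horizon: from every point of `D`, the target is missed for `N` steps with probability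
  -- at most `q < 1`.
  set N := Finset.univ.sup m with hN
  set q : ℝ≥0∞ := Finset.univ.sup fun c : D => notHit P T N c with hq
  have hq1 : q < 1 := (Finset.sup_lt_iff (by simp)).2 fun c _ =>
    (notHit_antitone (P := P) (T := T) c.1 (Finset.le_sup (Finset.mem_univ c))).trans_lt (hm c)
  set K : ℝ≥0∞ := Finset.univ.sup fun c : D => meanHittingTime P D c with hK
  have hKt : K < ∞ := (Finset.sup_lt_iff (by simp)).2 fun c _ => hfin c c.2
  have hK' : ∀ c ∈ D, meanHittingTime P D c ≤ K := fun c hc =>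
    Finset.le_sup (f := fun c : D => meanHittingTime P D c) (Finset.mem_univ ⟨c, hc⟩)
  set B : ℝ≥0∞ := K + N * (1 + K) with hB
  have hBt : B ≠ ∞ := by
    refine ENNReal.add_ne_top.2 ⟨hKt.ne, ENNReal.mul_ne_top (ENNReal.natCast_ne_top _) ?_⟩
    simp [hKt.ne]
  intro c hc
  refine lt_of_le_of_lt (meanHittingTime_le (u := B / (1 - q)) fun j => ?_)
    (ENNReal.div_lt_top hBt (tsub_pos_of_lt hq1).ne')
  -- `M` is at most `j`, hence finite, so `M ≤ B + q * M` can be solved; the resulting bound does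
  -- not depend on `j`.
  set M : ℝ≥0∞ := Finset.univ.sup fun c : D => truncHit P T j c with hM
  have hM' : ∀ c ∈ D, truncHit P T j c ≤ M := fun c hc =>
    Finset.le_sup (f := fun c : D => truncHit P T j c) (Finset.mem_univ ⟨c, hc⟩)
  have hMt : M ≠ ∞ :=
    ((Finset.sup_lt_iff (by simp)).2 fun c _ =>
      (truncHit_le j c.1).trans_lt (ENNReal.natCast_lt_top j)).ne
  refine (hM' c hc).trans (ENNReal.le_div_of_le_add_mul hMt hq1 (Finset.sup_le fun c _ => ?_))
  refine (truncHit_mono c.1 (Nat.le_add_left j N)).trans ((truncHit_add_le hK' hM' N c).trans ?_)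
  rw [hB]
  gcongr
  · exact hK' c c.2
  · exact Finset.le_sup (f := fun c : D => notHit P T N c) (Finset.mem_univ c)

/-! ### Positive recurrent states. -/

/-- An infinite mean at a successor other than `x` would pass back along an edge of positive
probability. -/
theorem meanHittingTime_lt_top_of_leadsTo {x y : α} (h : PositiveRecurrentState P x)
    (hxy : LeadsTo P x y) : meanHittingTime P {x} y < ∞ := by
  induction hxy with
  | refl => exact h
  | @tail w z _ hwz ih =>
    by_cases hz : z = x
    · exact hz ▸ h
    · by_contra hcon
      rw [not_lt_top_iff] at hcon
      refine ih.ne (top_le_iff.1 ?_)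
      rw [meanHittingTime_eq]
      refine le_add_left (le_trans ?_ (ENNReal.le_tsum z))
      simp [hz, hcon, ENNReal.mul_top ((PMF.mem_support_iff _ _).1 hwz)]

/-- Each excursion from `x` has a path to `y` available, so `y` is reached in finite mean time; a
return to `y` goes through `x`. -/
theorem PositiveRecurrentState.of_leadsTo {x y : α} (h : PositiveRecurrentState P x)
    (hxy : LeadsTo P x y) : PositiveRecurrentState P y := by
  rcases Relation.reflTransGen_iff_eq_or_transGen.1 hxy with rfl | hxy'
  · exact h
  have h1 : meanHittingTime P {y} x < ∞ :=
    meanHittingTime_lt_top_of_finite (Set.finite_singleton x) (by rintro _ rfl; exact h)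
      (by simpa using hxy') x rfl
  refine (meanHittingTime_le_add (D := {x}) (M := meanHittingTime P {y} x) (by simp) y).trans_lt ?_
  exact ENNReal.add_lt_top.2 ⟨meanHittingTime_lt_top_of_leadsTo h hxy, h1⟩

/-- If the chain always enters a finite set in finite mean time, then it always enters the set of
positive recurrent states in finite mean time. -/
theorem meanHittingTime_positiveRecurrent_lt_top (hC : C.Finite)
    (h : ∀ x, meanHittingTime P C x < ∞) (x : α) :
    meanHittingTime P {y | PositiveRecurrentState P y} x < ∞ := by
  set r : α → α → Prop := Relation.TransGen (fun x y => y ∈ (P x).support) with hr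
  set S : α → Set α := fun z => {w ∈ C | r z w} with hS
  have hSfin : ∀ z, (S z).Finite := fun z => hC.subset fun w hw => hw.1
  have hSmono : ∀ {z w}, w ∈ S z → S w ⊆ S z := fun hw v hv => ⟨hv.1, hw.2.trans hv.2⟩
  have hSne : ∀ z, (S z).Nonempty := fun z => by
    obtain ⟨y, hy, hzy⟩ := exists_transGen_of_meanHittingTime_lt_top (h z)
    exact ⟨y, hy, hzy⟩
  have hrec : ∀ z, (∀ w ∈ S z, z ∈ S w) → z ∈ C → PositiveRecurrentState P z := by
    intro z hz hzC
    have hzz : z ∈ S z := by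
      obtain ⟨w, hw⟩ := hSne z
      exact hSmono hw (hz w hw)
    -- A chain started at a point reachable from `z` meets no point of `C` outside `S z`.
    have hcongr : ∀ m y, r z y → notHit P (S z) m y = notHit P C m y := by
      intro m
      induction m with
      | zero => intros; rfl
      | succ m ih =>
        intro y hy
        refine tsum_congr fun w => ?_
        by_cases hw : P y w = 0
        · simp [hw]
        · have hzw : r z w := hy.tail ((PMF.mem_support_iff _ _).2 hw)
          have hiff : w ∈ S z ↔ w ∈ C := ⟨fun h => h.1, fun h => ⟨h, hzw⟩⟩
          by_cases hwC : w ∈ C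
          · simp [hwC, hiff]
          · simp [hwC, hiff, ih w hzw]
    refine meanHittingTime_lt_top_of_finite (hSfin z) (fun c hc => ?_) (fun c hc => ?_) z hzz
    · have : meanHittingTime P (S z) c = meanHittingTime P C c :=
        tsum_congr fun m => hcongr m c hc.2
      exact this ▸ h c
    · exact ⟨z, rfl, (hz c hc).2⟩
  have hto : ∀ c, ∃ y ∈ {y | PositiveRecurrentState P y}, r c y := by
    intro c
    -- Minimal cardinality makes `S` constant on `S z`, so the points of `S z` reach one another.
    obtain ⟨z, hz, hmin⟩ := (hSfin c).exists_minimalFor (fun z => (S z).ncard) _ (hSne c)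
    have heq : ∀ w ∈ S z, S w = S z := fun w hw =>
      Set.eq_of_subset_of_ncard_le (hSmono hw)
        (hmin (hSmono hz hw) (Set.ncard_le_ncard (hSmono hw) (hSfin z))) (hSfin z)
    obtain ⟨w, hw⟩ := hSne z
    refine ⟨w, hrec w (fun v hv => ?_) hw.1, hz.2.trans hw.2⟩
    rw [heq v (hSmono hw hv)]
    exact hw
  have hCR := meanHittingTime_lt_top_of_finite hC (fun c _ => h c) (fun c _ => hto c)
  have : Fintype C := hC.fintype
  refine (meanHittingTime_le_add (D := C) (M := Finset.univ.sup fun c : C =>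
    meanHittingTime P {y | PositiveRecurrentState P y} c) (fun c hc =>
    Finset.le_sup (f := fun c : C => meanHittingTime P {y | PositiveRecurrentState P y} c)
      (Finset.mem_univ ⟨c, hc⟩)) x).trans_lt ?_
  exact ENNReal.add_lt_top.2 ⟨h x, (Finset.sup_lt_iff (by simp)).2 fun c _ => hCR c c.2⟩

/-! ### A criterion against positive recurrence. -/

/-- A state is not positive recurrent if some subharmonic function with bounded increments vanishes
there and increases on average in the first step. -/
theorem not_positiveRecurrentState_of_drift {W : α → ℝ≥0∞} {x₀ : α} {B : ℝ≥0∞} (hB : B ≠ ∞)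
    (h0 : W x₀ = 0) (hsub : ∀ x, W x ≤ ∑' y, P x y * W y) (hpos : ∑' y, P x₀ y * W y ≠ 0)
    (hinc : ∀ x, ∀ y ∈ (P x).support, W y ≤ W x + B) : ¬ PositiveRecurrentState P x₀ := by
  -- Killing at `x₀` loses nothing because `W` vanishes there.
  have hk : ∀ x, killed P {x₀} W x = ∑' y, P x y * W y := fun x =>
    tsum_congr fun y => by
      by_cases hy : y = x₀
      · simp [hy, h0]
      · simp [hy]
  have hlow : ∀ m x, ∑' y, P x y * W y ≤ (killed P {x₀})^[m + 1] W x := by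
    intro m
    induction m with
    | zero => intro x; simp [hk]
    | succ m ih =>
      intro x
      rw [Function.iterate_succ_apply', ← hk]
      exact killed_mono fun y _ _ => (hsub y).trans (ih y)
  have hup : ∀ m x, (killed P {x₀})^[m] W x ≤ notHit P {x₀} m x * (W x + m * B) := by
    intro m
    induction m with
    | zero => intro x; simp [notHit]
    | succ m ih =>
      intro x
      rw [Function.iterate_succ_apply', notHit_succ, ← killed_mul_const]
      refine killed_mono fun y hy _ => (ih y).trans (mul_le_mul_right ?_ _)
      calc W y + m * B ≤ W x + B + m * B := by gcongr; exact hinc x y hy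
        _ = W x + (m + 1 : ℕ) * B := by push_cast; ring
  set δ := ∑' y, P x₀ y * W y with hδ
  intro hrec
  -- The mean of `W` over surviving paths stays at least `δ`, while `W ≤ (m + 1) * B` after `m + 1`
  -- steps. The tail is therefore at least a multiple of the harmonic sequence.
  have hlb : ∀ m : ℕ, δ / B * ((m + 1 : ℕ) : ℝ≥0∞)⁻¹ ≤ notHit P {x₀} (m + 1) x₀ := by
    intro m
    have h1 := (hlow m x₀).trans (hup (m + 1) x₀)
    rw [h0, zero_add] at h1
    rw [← div_eq_mul_inv]
    refine ENNReal.div_le_of_le_mul (ENNReal.div_le_of_le_mul ?_)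
    rwa [mul_assoc]
  have hdiv : ∑' m : ℕ, ((m + 1 : ℕ) : ℝ≥0∞)⁻¹ = ∞ := by
    by_contra hne
    have hs := ENNReal.summable_toReal hne
    refine Real.not_summable_natCast_inv ((summable_nat_add_iff 1).1 (hs.congr fun m => ?_))
    rw [ENNReal.toReal_inv, ENNReal.toReal_natCast]
  refine hrec.ne (top_le_iff.1 ?_)
  calc ∞ = δ / B * ∑' m : ℕ, ((m + 1 : ℕ) : ℝ≥0∞)⁻¹ := by
        rw [hdiv, ENNReal.mul_top (ENNReal.div_ne_zero.2 ⟨hpos, hB⟩)]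
    _ = ∑' m : ℕ, δ / B * ((m + 1 : ℕ) : ℝ≥0∞)⁻¹ := ENNReal.tsum_mul_left.symm
    _ ≤ ∑' m : ℕ, notHit P {x₀} (m + 1) x₀ := ENNReal.tsum_le_tsum hlb
    _ ≤ meanHittingTime P {x₀} x₀ := by
        exact ENNReal.tsum_comp_le_tsum_of_injective (add_left_injective 1) fun m =>
          notHit P {x₀} m x₀

end MarkovChain

namespace SLQ

variable {n d k : ℕ}

/-! ### Expectations -/

theorem mean_eq_sum {β : Type*} {p : PMF β} (hp : p.support.Finite) (f : β → ℝ) :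
    mean p f = ∑ x ∈ hp.toFinset, (p x).toReal * f x :=
  tsum_eq_sum fun x hx => by
    have : p x = 0 := by simpa [PMF.mem_support_iff] using hx
    simp [this]

theorem tsum_mul_eq_sum {β : Type*} {p : PMF β} (hp : p.support.Finite) (f : β → ℝ≥0∞) :
    ∑' x, p x * f x = ∑ x ∈ hp.toFinset, p x * f x :=
  tsum_eq_sum fun x hx => by
    have : p x = 0 := by simpa [PMF.mem_support_iff] using hx
    simp [this]

theorem sum_toReal_support {β : Type*} {p : PMF β} (hp : p.support.Finite) :
    ∑ x ∈ hp.toFinset, (p x).toReal = 1 := by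
  have h := tsum_mul_eq_sum hp fun _ => 1
  simp only [mul_one, PMF.tsum_coe] at h
  rw [← ENNReal.toReal_sum fun x _ => p.apply_ne_top x, ← h, ENNReal.toReal_one]

theorem ofReal_mean_of_nonneg {β : Type*} {p : PMF β} (hp : p.support.Finite) {f : β → ℝ}
    (hf : ∀ x ∈ p.support, 0 ≤ f x) :
    ENNReal.ofReal (mean p f) = ∑' x, p x * ENNReal.ofReal (f x) := by
  rw [mean_eq_sum hp, tsum_mul_eq_sum hp, ENNReal.ofReal_sum_of_nonneg]
  · refine Finset.sum_congr rfl fun x _ => ?_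
    rw [ENNReal.ofReal_mul ENNReal.toReal_nonneg, ENNReal.ofReal_toReal (p.apply_ne_top x)]
  · exact fun x hx => mul_nonneg ENNReal.toReal_nonneg (hf x (by simpa using hx))

theorem ofReal_mean_le {β : Type*} {p : PMF β} (hp : p.support.Finite) (f : β → ℝ) :
    ENNReal.ofReal (mean p f) ≤ ∑' x, p x * ENNReal.ofReal (f x) := by
  have h : mean p f ≤ mean p fun x => max (f x) 0 := by
    rw [mean_eq_sum hp, mean_eq_sum hp]
    gcongr
    exact le_max_left _ _
  refine (ENNReal.ofReal_le_ofReal h).trans ?_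
  rw [ofReal_mean_of_nonneg hp fun x _ => le_max_right _ _]
  simp [ENNReal.ofReal_max]

theorem tsum_bind_mul {β γ : Type*} (p : PMF β) (f : β → PMF γ) (F : γ → ℝ≥0∞) :
    ∑' y, p.bind f y * F y = ∑' x, p x * ∑' y, f x y * F y := by
  simp only [PMF.bind_apply, ← ENNReal.tsum_mul_right, ← ENNReal.tsum_mul_left]
  rw [ENNReal.tsum_comm]
  simp only [mul_assoc]

theorem mean_affine {ρ : PMF (ℕ × (Fin n → ℕ))} (hρ : ρ.support.Finite) {Λ : ℝ} {μ : Fin n → ℝ}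
    (hA : mean ρ (fun p => (p.1 : ℝ)) = Λ) (hS : ∀ i, mean ρ (fun p => (p.2 i : ℝ)) = μ i)
    (c b : ℝ) (w : Fin n → ℝ) :
    mean ρ (fun p => c + b * p.1 + ∑ i, w i * p.2 i) = c + b * Λ + ∑ i, w i * μ i := by
  simp only [← hA, ← hS, mean_eq_sum hρ, Finset.mul_sum, mul_add, Finset.sum_add_distrib]
  congr 1
  · congr 1
    · rw [← Finset.sum_mul, sum_toReal_support, one_mul]
    · exact Finset.sum_congr rfl fun _ _ => by ring
  · rw [Finset.sum_comm]
    exact Finset.sum_congr rfl fun _ _ => Finset.sum_congr rfl fun _ _ => by ring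

section

variable {hd : d < n} {hk : 0 < k} {ρ : PMF (ℕ × (Fin n → ℕ))} {Λ : ℝ} {μ : Fin n → ℝ}

/-- Reduces a drift estimate to a pathwise bound affine in the arrivals and services, so only their
means enter. Tie-breaking is harmless because the bound covers every possible successor. -/
theorem tsum_step_le (hρ : ρ.support.Finite) (hA : mean ρ (fun p => (p.1 : ℝ)) = Λ)
    (hS : ∀ i, mean ρ (fun p => (p.2 i : ℝ)) = μ i) {F : State n d k → ℝ} (hF : ∀ s, 0 ≤ F s)
    {s : State n d k} {c b : ℝ} {w : Fin n → ℝ}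
    (h : ∀ p ∈ ρ.support, ∀ s' ∈ (next hd hk s (s.nextQ p.1 p.2)).support,
      F s' ≤ c + b * p.1 + ∑ i, w i * p.2 i) :
    ∑' y, step hd hk ρ s y * ENNReal.ofReal (F y)
      ≤ ENNReal.ofReal (c + b * Λ + ∑ i, w i * μ i) := by
  rw [step, tsum_bind_mul, ← mean_affine hρ hA hS, ofReal_mean_of_nonneg hρ]
  · refine MarkovChain.tsum_mul_le_of_support fun p hp => ?_
    refine (MarkovChain.tsum_mul_le_of_support fun y hy =>
      ENNReal.ofReal_le_ofReal (h p hp y hy)).trans ?_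
    rw [ENNReal.tsum_mul_right, PMF.tsum_coe, one_mul]
  · intro p hp
    obtain ⟨y, hy⟩ := (next hd hk s (s.nextQ p.1 p.2)).support_nonempty
    exact (hF y).trans (h p hp y hy)

theorem le_tsum_step (hρ : ρ.support.Finite) (hA : mean ρ (fun p => (p.1 : ℝ)) = Λ)
    (hS : ∀ i, mean ρ (fun p => (p.2 i : ℝ)) = μ i) {F : State n d k → ℝ}
    {s : State n d k} {c b : ℝ} {w : Fin n → ℝ}
    (h : ∀ p ∈ ρ.support, ∀ s' ∈ (next hd hk s (s.nextQ p.1 p.2)).support,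
      c + b * p.1 + ∑ i, w i * p.2 i ≤ F s') :
    ENNReal.ofReal (c + b * Λ + ∑ i, w i * μ i)
      ≤ ∑' y, step hd hk ρ s y * ENNReal.ofReal (F y) := by
  rw [step, tsum_bind_mul, ← mean_affine hρ hA hS]
  refine (ofReal_mean_le hρ _).trans (MarkovChain.tsum_mul_le_of_support fun p hp => ?_)
  refine le_trans ?_ (MarkovChain.tsum_mul_le_of_support fun y hy =>
    ENNReal.ofReal_le_ofReal (h p hp y hy))
  rw [ENNReal.tsum_mul_right, PMF.tsum_coe, one_mul]

end

theorem finite_support_of_le {ρ : PMF (ℕ × (Fin n → ℕ))} {A S : ℝ}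
    (hA : ∀ p ∈ ρ.support, (p.1 : ℝ) ≤ A) (hS : ∀ p ∈ ρ.support, ∀ i, (p.2 i : ℝ) ≤ S) :
    ρ.support.Finite := by
  refine ((Set.finite_Iic ⌊A⌋₊).prod (Set.Finite.pi' fun _ => Set.finite_Iic ⌊S⌋₊)).subset ?_
  exact fun p hp => ⟨Nat.le_floor (hA p hp), fun i => Nat.le_floor (hS p hp i)⟩

/-! ### The transitions -/

/-- The number of slots, from the present one to the last one before the next sampling, in which
the arrivals are sent to queue `i`. -/
def State.rem (s : State n d k) (i : Fin n) : ℕ :=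
  if i ∈ s.skip.1 then 0 else k - 1 - s.round.1 + if s.cur ≤ i then 1 else 0

theorem State.rem_le (s : State n d k) (i : Fin n) : s.rem i ≤ k := by
  have := s.round.2
  unfold State.rem
  split_ifs <;> omega

theorem State.le_iff_of_later_empty {s : State n d k} (h : ¬ s.later.Nonempty) {i : Fin n}
    (hi : i ∉ s.skip.1) : s.cur ≤ i ↔ i = s.cur := by
  refine ⟨fun hle => ?_, fun h => h.ge⟩
  by_contra hne
  exact h ⟨i, Finset.mem_filter.2
    ⟨Finset.mem_compl.2 hi, lt_of_le_of_ne hle (Ne.symm hne)⟩⟩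

/-- All that is needed of the round-robin rule: the order inside a round drops out and only the
counts `rem` remain. -/
theorem of_mem_support_next {hd : d < n} {hk : 0 < k} {s s' : State n d k} {Q' : Fin n → ℕ}
    (h : s' ∈ (next hd hk s Q').support) : s'.Q = Q' ∧
      ((∀ i, s'.rem i + (if i = s.cur then 1 else 0) = s.rem i) ∨
        ((∀ i, s.rem i = if i = s.cur then 1 else 0) ∧
          ∃ J ∈ longest d Q', ∀ i, s'.rem i = if i ∈ J.1 then 0 else k)) := by
  have hcur : ∀ {i}, i ∈ s.skip.1 → i ≠ s.cur := fun hi h => s.cur_notMem (h ▸ hi)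
  have hround := s.round.2
  unfold next at h
  split_ifs at h with h1 h2
  · rw [PMF.support_pure, Set.mem_singleton_iff] at h
    subst h
    refine ⟨rfl, .inl fun i => ?_⟩
    by_cases hi : i ∈ s.skip.1
    · simp [State.rem, hi, hcur hi]
    · have : s.later.min' h1 ≤ i ↔ s.cur < i := by
        constructor
        · intro h
          exact (Finset.mem_filter.1 (s.later.min'_mem h1)).2.trans_le h
        · exact fun h => Finset.min'_le _ _ (Finset.mem_filter.2 ⟨Finset.mem_compl.2 hi, h⟩)
      simp only [State.rem, hi, this, if_false, add_assoc]
      congr 1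
      rcases lt_trichotomy i s.cur with h | h | h
      · simp [h.not_ge, h.not_gt, h.ne]
      · simp [h]
      · simp [h.le, h, h.ne']
  · rw [PMF.support_pure, Set.mem_singleton_iff] at h
    subst h
    refine ⟨rfl, .inl fun i => ?_⟩
    by_cases hi : i ∈ s.skip.1
    · simp [State.rem, hi, hcur hi]
    · have : (s.skip.1ᶜ).min' (compl_nonempty hd s.skip) ≤ i :=
        Finset.min'_le _ _ (Finset.mem_compl.2 hi)
      simp only [State.rem, hi, this, if_false, if_true, State.le_iff_of_later_empty h1 hi]
      split_ifs <;> omega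
  · rw [PMF.support_map] at h
    obtain ⟨J, hJ, rfl⟩ := h
    rw [PMF.mem_support_uniformOfFinset_iff] at hJ
    refine ⟨rfl, .inr ⟨fun i => ?_, J, hJ, fun i => ?_⟩⟩
    · by_cases hi : i ∈ s.skip.1
      · simp [State.rem, hi, hcur hi]
      · simp only [State.rem, hi, if_false, State.le_iff_of_later_empty h1 hi]
        split_ifs <;> omega
    · by_cases hi : i ∈ J.1
      · simp [State.rem, start, hi]
      · have : (J.1ᶜ).min' (compl_nonempty hd J) ≤ i :=
          Finset.min'_le _ _ (Finset.mem_compl.2 hi)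
        simp only [State.rem, start, hi, this, if_false, if_true]
        omega

theorem sum_ite_notMem (J : Skip n d) (I : Finset (Fin n)) (x : ℝ) :
    ∑ i ∈ I, (if i ∈ J.1 then 0 else x) = (I \ J.1).card * x := by
  rw [Finset.sum_ite, Finset.sum_const_zero, zero_add, Finset.sum_const, nsmul_eq_mul,
    Finset.filter_notMem_eq_sdiff]

theorem card_univ_sdiff (J : Skip n d) : ((Finset.univ \ J.1).card : ℝ) = n - d := by
  rw [Finset.cast_card_sdiff (Finset.subset_univ _), J.2, Finset.card_univ, Fintype.card_fin]

theorem finite_setOf_sum_le (L : ℝ) : {s : State n d k | ∑ i, (s.Q i : ℝ) ≤ L}.Finite := by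
  have hinj : Function.Injective
      fun s : State n d k => (s.Q, s.skip, s.cur, s.round) := by
    rintro ⟨⟩ ⟨⟩ h
    simp only [Prod.mk.injEq] at h
    obtain ⟨rfl, rfl, rfl, rfl⟩ := h
    rfl
  have hfin : ((Set.univ.pi fun _ : Fin n => Set.Iic ⌊L⌋₊) ×ˢ
      (Set.univ : Set (Skip n d × Fin n × Fin k))).Finite :=
    (Set.Finite.pi fun _ => Set.finite_Iic _).prod Set.finite_univ
  refine (hfin.preimage hinj.injOn).subset fun s hs => ⟨fun i _ => ?_, trivial⟩
  refine Nat.le_floor (le_trans ?_ hs)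
  exact Finset.single_le_sum (f := fun i => (s.Q i : ℝ)) (fun _ _ => Nat.cast_nonneg _)
    (Finset.mem_univ i)

/-- A bound on all upper level sets of `Q` gives a bound on the work that goes to the queues
outside a set of longest queues. -/
theorem sum_notMem_longest_le {Q : Fin n → ℕ} {J : Skip n d} (hJ : J ∈ longest d Q) {a : ℝ}
    {w : Fin n → ℝ} (hw : ∀ i, 0 ≤ w i)
    (h : ∀ I : Finset (Fin n), d + 1 ≤ I.card → a * (I.card - d) ≤ ∑ i ∈ I, w i) :
    ∑ i, (Q i : ℝ) * (if i ∈ J.1 then 0 else a) ≤ ∑ i, (Q i : ℝ) * w i := by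
  have hJ' : ∀ i ∈ J.1, ∀ j ∉ J.1, Q j ≤ Q i := by simpa [longest] using hJ
  set N := Finset.univ.sup Q with hN
  -- Layer-cake decomposition; the inequality is then checked for each level set `I` separately.
  have hQ : ∀ i, (Q i : ℝ) = ∑ t ∈ Finset.range N, if t < Q i then 1 else 0 := fun i => by
    have : (Finset.range N).filter (fun t => t < Q i) = Finset.range (Q i) := by
      ext t
      have := Finset.le_sup (f := Q) (Finset.mem_univ i)
      simp only [Finset.mem_filter, Finset.mem_range]
      omega
    rw [Finset.sum_boole, this, Finset.card_range]
  have hlayer : ∀ v : Fin n → ℝ, ∑ i, (Q i : ℝ) * v i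
      = ∑ t ∈ Finset.range N, ∑ i ∈ Finset.univ.filter (fun i => t < Q i), v i := fun v => by
    simp only [hQ, Finset.sum_mul, Finset.sum_filter]
    rw [Finset.sum_comm]
    simp only [ite_mul, one_mul, zero_mul]
  rw [hlayer, hlayer]
  refine Finset.sum_le_sum fun t _ => ?_
  set I := Finset.univ.filter fun i => t < Q i with hI
  rw [sum_ite_notMem]
  have hwI : 0 ≤ ∑ i ∈ I, w i := Finset.sum_nonneg fun i _ => hw i
  by_cases hJI : J.1 ⊆ I
  · have hcard := Finset.cast_card_sdiff (R := ℝ) hJI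
    rw [J.2] at hcard
    rw [hcard]
    by_cases hc : d + 1 ≤ I.card
    · rw [mul_comm]
      exact h I hc
    · have h1 := Finset.card_le_card hJI
      rw [J.2] at h1
      have h2 : (I.card : ℝ) = d := by exact_mod_cast (by omega : I.card = d)
      simpa [h2] using hwI
  -- A queue of `J` has length at most `t`, hence so does every queue outside `J`.
  · obtain ⟨i, hi, hiI⟩ := Finset.not_subset.1 hJI
    have hempty : I \ J.1 = ∅ := by
      refine Finset.sdiff_eq_empty_iff_subset.2 fun j hj => ?_
      by_contra hjJ
      have h1 := hJ' i hi j hjJ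
      simp only [hI, Finset.mem_filter, Finset.mem_univ, true_and] at hiI hj
      omega
    simpa [hempty] using hwI

end SLQ

namespace SLQ

variable {n d k : ℕ}

/-! ### Stability -/

theorem cast_nextQ (s : State n d k) (a : ℕ) (σ : Fin n → ℕ) (i : Fin n) :
    (s.nextQ a σ i : ℝ) = max ((s.Q i : ℝ) + a * (if i = s.cur then 1 else 0) - σ i) 0 := by
  have hcast : ∀ x y : ℕ, ((x - y : ℕ) : ℝ) = max ((x : ℝ) - y) 0 := fun x y => by
    rcases le_total y x with h | h
    · rw [Nat.cast_sub h, max_eq_left (sub_nonneg.2 (Nat.cast_le.2 h))]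
    · rw [Nat.sub_eq_zero_of_le h, max_eq_right (sub_nonpos.2 (Nat.cast_le.2 h)), Nat.cast_zero]
  rw [State.nextQ, hcast]
  push_cast
  simp

theorem sum_ite_cur (s : State n d k) : ∑ i, (if i = s.cur then 1 else 0 : ℝ) = 1 := by
  simp

/-- The mean net amount of work that queue `i` is to receive before the next sampling. -/
noncomputable def corr (Λ : ℝ) (μ : Fin n → ℝ) (s : State n d k) (i : Fin n) : ℝ :=
  Λ * s.rem i - μ i * ∑ j, (s.rem j : ℝ)

/-- The Lyapunov function: the squared length of the vector of the queue lengths that are expected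
at the next sampling, plus a multiple of the time until then. -/
noncomputable def lyapunov (Λ : ℝ) (μ : Fin n → ℝ) (K : ℝ) (s : State n d k) : ℝ :=
  ∑ i, (s.Q i + corr Λ μ s i) ^ 2 + K * ∑ j, (s.rem j : ℝ)

theorem sum_rem_le (s : State n d k) : ∑ j, (s.rem j : ℝ) ≤ k * n := by
  have := Finset.sum_le_card_nsmul Finset.univ (fun j => (s.rem j : ℝ)) k
    fun j _ => Nat.cast_le.2 (s.rem_le j)
  simpa [mul_comm] using this

theorem abs_corr_le {Λ S : ℝ} {μ : Fin n → ℝ} (hΛ : 0 ≤ Λ) (hμ0 : ∀ i, 0 ≤ μ i)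
    (hμS : ∀ i, μ i ≤ S) (s : State n d k) (i : Fin n) :
    |corr Λ μ s i| ≤ Λ * k + S * (k * n) := by
  have h0 : (0 : ℝ) ≤ ∑ j, (s.rem j : ℝ) := Finset.sum_nonneg fun _ _ => Nat.cast_nonneg _
  have h1 : Λ * s.rem i ≤ Λ * k := by gcongr; exact s.rem_le i
  have h2 : μ i * ∑ j, (s.rem j : ℝ) ≤ S * (k * n) :=
    mul_le_mul (hμS i) (sum_rem_le s) h0 ((hμ0 i).trans (hμS i))
  have h3 : 0 ≤ Λ * s.rem i := by positivity
  have h4 : 0 ≤ μ i * ∑ j, (s.rem j : ℝ) := mul_nonneg (hμ0 i) h0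
  rw [corr, abs_le]
  constructor <;> linarith

/-- The unused service `U` is at most `S` and vanishes once `q ≥ S`, so `U * q` is bounded although
`q` is not. With `l` and `m` the means of `v` and `σ`, the linear term averages to zero. -/
theorem sq_max_add_le {q v l c σ m A S C : ℝ} (hq : 0 ≤ q) (hv : 0 ≤ v) (hvA : v ≤ A)
    (hl : 0 ≤ l) (hlA : l ≤ A) (hσ : 0 ≤ σ) (hσS : σ ≤ S) (hm : 0 ≤ m) (hmS : m ≤ S)
    (hc : |c| ≤ C) :
    (max (q + v - σ) 0 + (c - l + m)) ^ 2
      ≤ (q + c) ^ 2 + 2 * (q + c) * ((v - l) - (σ - m))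
        + (2 * S ^ 2 + 2 * C * S + (A + 2 * S) ^ 2) := by
  obtain ⟨hc1, hc2⟩ := abs_le.1 hc
  have hS : 0 ≤ S := hσ.trans hσS
  have hC : 0 ≤ C := (abs_nonneg c).trans hc
  set U := max (q + v - σ) 0 - (q + v - σ) with hU
  have hU0 : 0 ≤ U := sub_nonneg.2 (le_max_left _ _)
  have hUS : U ≤ S := by
    rw [hU, sub_le_iff_le_add]
    exact max_le (by linarith) (by linarith)
  have hUq : U * q ≤ S ^ 2 := by
    rcases le_total q S with h | h
    · calc U * q ≤ S * S := mul_le_mul hUS h hq hS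
        _ = _ := by ring
    · have : U = 0 := by rw [hU, max_eq_left (by linarith), sub_self]
      rw [this, zero_mul]
      positivity
  have hUc : U * c ≤ C * S := by
    calc U * c ≤ U * C := by gcongr
      _ ≤ S * C := by gcongr
      _ = _ := mul_comm _ _
  have hsq : ((v - l) - (σ - m) + U) ^ 2 ≤ (A + 2 * S) ^ 2 :=
    sq_le_sq' (by linarith) (by linarith)
  have hmax : max (q + v - σ) 0 = q + v - σ + U := by rw [hU]; ring
  rw [hmax]
  nlinarith

/-- There are finitely many strict inequalities, so they survive a small decrease of the service
rates. -/
theorem exists_slack {Λ : ℝ} {μ : Fin n → ℝ} (hμ : ∀ i, 0 < μ i)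
    (h : ∀ I : Finset (Fin n), d + 1 ≤ I.card → Λ * (I.card - d) < (n - d) * ∑ i ∈ I, μ i) :
    ∃ ε > 0, (∀ i, ε ≤ μ i) ∧ ∀ I : Finset (Fin n), d + 1 ≤ I.card →
      Λ * (I.card - d) ≤ ∑ i ∈ I, ((n : ℝ) - d) * (μ i - ε) := by
  have h1 : ∀ i, ∀ᶠ ε in nhdsWithin (0 : ℝ) (Set.Ioi 0), ε ≤ μ i := fun i =>
    nhdsWithin_le_nhds ((eventually_lt_nhds (hμ i)).mono fun _ h => h.le)
  have h2 : ∀ I : Finset (Fin n), ∀ᶠ ε in nhdsWithin (0 : ℝ) (Set.Ioi 0), d + 1 ≤ I.card →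
      Λ * (I.card - d) ≤ ∑ i ∈ I, ((n : ℝ) - d) * (μ i - ε) := fun I => by
    by_cases hI : d + 1 ≤ I.card
    · have hc : Continuous fun ε : ℝ => ∑ i ∈ I, ((n : ℝ) - d) * (μ i - ε) := by fun_prop
      have := (hc.tendsto 0).eventually_const_lt (u := Λ * (I.card - d))
        (by simpa [← Finset.mul_sum] using h I hI)
      exact nhdsWithin_le_nhds (this.mono fun _ h _ => h.le)
    · exact .of_forall fun _ h => absurd h hI
  obtain ⟨ε, ⟨hε1, hε2⟩, hε⟩ := ((Filter.eventually_all.2 h1).and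
    (Filter.eventually_all.2 h2)).and self_mem_nhdsWithin |>.exists
  exact ⟨ε, hε, hε1, hε2⟩

/-- The drift bound for the Lyapunov function. -/
theorem lyapunov_le {hd : d < n} {hk : 0 < k} {Λ A S ε K : ℝ} {μ : Fin n → ℝ} (hΛ : 0 ≤ Λ)
    (hΛA : Λ ≤ A) (hμ0 : ∀ i, 0 ≤ μ i) (hμS : ∀ i, μ i ≤ S) (hε : 0 ≤ ε) (hεμ : ∀ i, ε ≤ μ i)
    (hI : ∀ I : Finset (Fin n), d + 1 ≤ I.card →
      Λ * (I.card - d) ≤ ∑ i ∈ I, ((n : ℝ) - d) * (μ i - ε))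
    {C E : ℝ} (hC : C = Λ * k + S * (k * n))
    (hK : K = n * (2 * S ^ 2 + 2 * C * S + (A + 2 * S) ^ 2) + 1)
    (hE : E = n * C ^ 2 + K * (k * n) + 2 * ε * (n * S))
    {s s' : State n d k} {a : ℕ} {σ : Fin n → ℕ} (ha : (a : ℝ) ≤ A) (hσ : ∀ i, (σ i : ℝ) ≤ S)
    (hs' : s' ∈ (next hd hk s (s.nextQ a σ)).support) :
    lyapunov Λ μ K s' ≤ lyapunov Λ μ K s - 1
      + (if 2 * ε * ∑ i, (s.Q i : ℝ) ≤ E then E else 0)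
      + ∑ i, 2 * (s.Q i + corr Λ μ s i) *
        ((a * (if i = s.cur then 1 else 0) - Λ * (if i = s.cur then 1 else 0))
          - (σ i - μ i)) := by
  set Y : Fin n → ℝ := fun i => if i = s.cur then 1 else 0 with hY
  have hY0 : ∀ i, 0 ≤ Y i := fun i => by simp only [hY]; split_ifs <;> norm_num
  have hY1 : ∀ i, Y i ≤ 1 := fun i => by simp only [hY]; split_ifs <;> norm_num
  have hsumY : ∑ i, Y i = 1 := sum_ite_cur s
  set lin := ∑ i, 2 * (s.Q i + corr Λ μ s i) * ((a * Y i - Λ * Y i) - (σ i - μ i)) with hlin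
  have hA : 0 ≤ A := hΛ.trans hΛA
  have hS : 0 ≤ S := (hμ0 s.cur).trans (hμS s.cur)
  have hcorr : ∀ (s : State n d k) i, |corr Λ μ s i| ≤ C := fun s i =>
    hC ▸ abs_corr_le hΛ hμ0 hμS s i
  have hC0 : 0 ≤ C := (abs_nonneg _).trans (hcorr s s.cur)
  have hK0 : 0 ≤ K := by rw [hK]; positivity
  have hE0 : 0 ≤ E := by rw [hE]; positivity
  obtain ⟨hQ, hcase⟩ := of_mem_support_next hs'
  have hQ' : ∀ i, (s'.Q i : ℝ) = max ((s.Q i : ℝ) + a * Y i - σ i) 0 := fun i => by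
    rw [hQ, cast_nextQ]
  -- `K - 1` is `n` times the error in `sq_max_add_le`, so the loss of one remaining slot, worth
  -- `K`, pays for it and leaves `-1`.
  have hsq : ∑ i, ((s'.Q i : ℝ) + (corr Λ μ s i - Λ * Y i + μ i)) ^ 2
      ≤ ∑ i, ((s.Q i : ℝ) + corr Λ μ s i) ^ 2 + lin + (K - 1) := by
    have hn : K - 1 = ∑ _i : Fin n, (2 * S ^ 2 + 2 * C * S + (A + 2 * S) ^ 2) := by
      rw [hK, Finset.sum_const, Finset.card_univ, Fintype.card_fin, nsmul_eq_mul,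
        add_sub_cancel_right]
    rw [hlin, hn, ← Finset.sum_add_distrib, ← Finset.sum_add_distrib]
    refine Finset.sum_le_sum fun i _ => ?_
    rw [hQ']
    refine sq_max_add_le (Nat.cast_nonneg _) (mul_nonneg (Nat.cast_nonneg _) (hY0 i)) ?_
      (mul_nonneg hΛ (hY0 i)) ?_ (Nat.cast_nonneg _) (hσ i) (hμ0 i) (hμS i) (hcorr s i)
    · exact (mul_le_of_le_one_right (Nat.cast_nonneg _) (hY1 i)).trans ha
    · exact (mul_le_of_le_one_right hΛ (hY1 i)).trans hΛA
  have hind : 0 ≤ (if 2 * ε * ∑ i, (s.Q i : ℝ) ≤ E then E else 0) := by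
    split_ifs <;> first | exact hE0 | exact le_rfl
  rcases hcase with hrem | ⟨hrem, J, hJ, hrem'⟩
  · have hr : ∀ i, (s'.rem i : ℝ) = s.rem i - Y i := fun i => by
      rw [← hrem i]
      push_cast
      simp only [hY]
      ring
    have hsum : ∑ j, (s'.rem j : ℝ) = ∑ j, (s.rem j : ℝ) - 1 := by
      simp only [hr, Finset.sum_sub_distrib, hsumY]
    have hc : ∀ i, corr Λ μ s' i = corr Λ μ s i - Λ * Y i + μ i := fun i => by
      rw [corr, corr, hsum, hr]
      ring
    simp only [lyapunov, hc, hsum]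
    linarith
  · have hr : ∀ i, (s.rem i : ℝ) = Y i := fun i => by
      rw [hrem i]
      simp [hY]
    have hsum : ∑ j, (s.rem j : ℝ) = 1 := by simp only [hr, hsumY]
    -- The old correction is used up at the sampling; the new one enters only through the cross term
    -- and bounded terms.
    have hc : ∀ i, corr Λ μ s i - Λ * Y i + μ i = 0 := fun i => by
      rw [corr, hsum, hr]
      ring
    simp only [hc, add_zero] at hsq
    have hr' : ∀ i, (s'.rem i : ℝ) = if i ∈ J.1 then 0 else (k : ℝ) := fun i => by
      rw [hrem' i]
      push_cast
      rfl
    have hsum' : ∑ j, (s'.rem j : ℝ) = ((n : ℝ) - d) * k := by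
      simp only [hr']
      rw [sum_ite_notMem, card_univ_sdiff]
    have hnd : (1 : ℝ) ≤ n - d := by
      have : ((d + 1 : ℕ) : ℝ) ≤ n := Nat.cast_le.2 hd
      push_cast at this
      linarith
    have hk1 : (1 : ℝ) ≤ k := by exact_mod_cast hk
    have hlayer := sum_notMem_longest_le hJ (a := Λ) (w := fun i => ((n : ℝ) - d) * (μ i - ε))
      (fun i => mul_nonneg (by linarith) (sub_nonneg.2 (hεμ i))) hI
    rw [← hQ] at hlayer
    have hcross : ∑ i, (s'.Q i : ℝ) * corr Λ μ s' i
        = k * (∑ i, (s'.Q i : ℝ) * (if i ∈ J.1 then 0 else Λ)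
          - ∑ i, (s'.Q i : ℝ) * (((n : ℝ) - d) * (μ i - ε)))
          - k * ((n : ℝ) - d) * (ε * ∑ i, (s'.Q i : ℝ)) := by
      simp only [Finset.mul_sum, ← Finset.sum_sub_distrib]
      refine Finset.sum_congr rfl fun i _ => ?_
      rw [corr, hsum', hr']
      split_ifs <;> ring
    have hQ0 : 0 ≤ ε * ∑ i, (s'.Q i : ℝ) :=
      mul_nonneg hε (Finset.sum_nonneg fun _ _ => Nat.cast_nonneg _)
    have hneg : ∑ i, (s'.Q i : ℝ) * corr Λ μ s' i ≤ - (ε * ∑ i, (s'.Q i : ℝ)) := by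
      have h1 : 1 * (ε * ∑ i, (s'.Q i : ℝ)) ≤ k * ((n : ℝ) - d) * (ε * ∑ i, (s'.Q i : ℝ)) :=
        mul_le_mul_of_nonneg_right (one_le_mul_of_one_le_of_one_le hk1 hnd) hQ0
      have h2 := mul_nonneg (zero_le_one.trans hk1) (sub_nonneg.2 hlayer)
      rw [hcross]
      linarith
    -- Moves the negative drift back to the present state; this costs the term `2 * ε * (n * S)` of
    -- `E`.
    have hQsum : ∑ i, (s.Q i : ℝ) - n * S ≤ ∑ i, (s'.Q i : ℝ) := by
      have : (n : ℝ) * S = ∑ _i : Fin n, S := by simp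
      rw [this, ← Finset.sum_sub_distrib]
      refine Finset.sum_le_sum fun i _ => ?_
      rw [hQ']
      refine le_trans ?_ (le_max_left _ _)
      have := mul_nonneg (Nat.cast_nonneg (α := ℝ) a) (hY0 i)
      linarith [hσ i]
    have hεsum := mul_le_mul_of_nonneg_left hQsum hε
    have hcsq : ∑ i, corr Λ μ s' i ^ 2 ≤ n * C ^ 2 := by
      have : (n : ℝ) * C ^ 2 = ∑ _i : Fin n, C ^ 2 := by simp
      rw [this]
      exact Finset.sum_le_sum fun i _ => sq_le_sq' (abs_le.1 (hcorr s' i)).1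
        (abs_le.1 (hcorr s' i)).2
    have hexp : lyapunov Λ μ K s' = ∑ i, (s'.Q i : ℝ) ^ 2
        + 2 * ∑ i, (s'.Q i : ℝ) * corr Λ μ s' i + ∑ i, corr Λ μ s' i ^ 2
        + K * ∑ j, (s'.rem j : ℝ) := by
      rw [lyapunov]
      congr 1
      rw [Finset.mul_sum, ← Finset.sum_add_distrib, ← Finset.sum_add_distrib]
      exact Finset.sum_congr rfl fun i _ => by ring
    have hKrem : K * ∑ j, (s'.rem j : ℝ) ≤ K * (k * n) := by
      gcongr
      exact sum_rem_le s'
    have hs : lyapunov Λ μ K s = ∑ i, ((s.Q i : ℝ) + corr Λ μ s i) ^ 2 + K := by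
      rw [lyapunov, hsum, mul_one]
    have hind' : E - 2 * ε * ∑ i, (s.Q i : ℝ)
        ≤ (if 2 * ε * ∑ i, (s.Q i : ℝ) ≤ E then E else 0) := by
      have : 0 ≤ 2 * ε * ∑ i, (s.Q i : ℝ) :=
        mul_nonneg (by linarith) (Finset.sum_nonneg fun _ _ => Nat.cast_nonneg _)
      split_ifs <;> linarith
    rw [hexp, hs]
    linarith

/-- Below the threshold, the chain enters the set of positive recurrent states in finite mean
time. -/
theorem meanHittingTime_positiveRecurrent_lt_top {hd : d < n} {hk : 0 < k}
    {ρ : PMF (ℕ × (Fin n → ℕ))} {Λ A S : ℝ} {μ : Fin n → ℝ}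
    (hAmax : ∀ p ∈ ρ.support, (p.1 : ℝ) ≤ A) (hSmax : ∀ p ∈ ρ.support, ∀ i, (p.2 i : ℝ) ≤ S)
    (hA : mean ρ (fun p => (p.1 : ℝ)) = Λ) (hS : ∀ i, mean ρ (fun p => (p.2 i : ℝ)) = μ i)
    (hμ : ∀ i, 0 < μ i)
    (h : ∀ I : Finset (Fin n), d + 1 ≤ I.card → Λ * (I.card - d) < (n - d) * ∑ i ∈ I, μ i)
    (x : State n d k) :
    MarkovChain.meanHittingTime (step hd hk ρ)
      {y | MarkovChain.PositiveRecurrentState (step hd hk ρ) y} x < ∞ := by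
  obtain ⟨ε, hε, hεμ, hI⟩ := exists_slack hμ h
  have hρ := finite_support_of_le hAmax hSmax
  have hΛ : 0 ≤ Λ :=
    hA ▸ tsum_nonneg fun p => mul_nonneg ENNReal.toReal_nonneg (Nat.cast_nonneg _)
  set A' := |A| + Λ with hA'
  set S' := |S| + ∑ i, μ i with hS'
  have hμsum : ∀ i, μ i ≤ ∑ i, μ i := fun i =>
    Finset.single_le_sum (fun j _ => (hμ j).le) (Finset.mem_univ i)
  have hμS : ∀ i, μ i ≤ S' := fun i => (hμsum i).trans (le_add_of_nonneg_left (abs_nonneg S))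
  have hsum0 : 0 ≤ ∑ i, μ i := Finset.sum_nonneg fun i _ => (hμ i).le
  obtain ⟨C, hC⟩ : ∃ C, C = Λ * k + S' * (k * n) := ⟨_, rfl⟩
  obtain ⟨K, hK⟩ : ∃ K, K = n * (2 * S' ^ 2 + 2 * C * S' + (A' + 2 * S') ^ 2) + 1 := ⟨_, rfl⟩
  obtain ⟨E, hE⟩ : ∃ E, E = n * C ^ 2 + K * (k * n) + 2 * ε * (n * S') := ⟨_, rfl⟩
  have hA0 : 0 ≤ A' := by positivity
  have hS0 : 0 ≤ S' := by positivity
  have hC0 : 0 ≤ C := by rw [hC]; positivity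
  have hK0 : 0 ≤ K := by rw [hK]; positivity
  have hE0 : 0 ≤ E := by rw [hE]; positivity
  have hL0 : ∀ s : State n d k, 0 ≤ lyapunov Λ μ K s := fun s => by
    unfold lyapunov
    positivity
  -- The added 1 expresses the drift `-1` without subtraction in `ℝ≥0∞`.
  have hdrift : ∀ s : State n d k,
      ∑' y, step hd hk ρ s y * ENNReal.ofReal (lyapunov Λ μ K y + 1)
        ≤ ENNReal.ofReal (lyapunov Λ μ K s
          + (if 2 * ε * ∑ i, (s.Q i : ℝ) ≤ E then E else 0)) := by
    intro s
    set e := (if 2 * ε * ∑ i, (s.Q i : ℝ) ≤ E then E else 0) with he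
    set Y : Fin n → ℝ := fun i => if i = s.cur then 1 else 0 with hY
    set v : Fin n → ℝ := fun i => 2 * (s.Q i + corr Λ μ s i) with hv
    refine (tsum_step_le hρ hA hS (fun s => add_nonneg (hL0 s) zero_le_one)
      (c := lyapunov Λ μ K s + e - ∑ i, v i * (Λ * Y i - μ i))
      (b := ∑ i, v i * Y i) (w := fun i => - v i) ?_).trans_eq (congrArg _ ?_)
    · intro p hp s' hs'
      have hbound := lyapunov_le hΛ (le_add_of_nonneg_left (abs_nonneg A)) (fun i => (hμ i).le)
        hμS hε.le hεμ hI hC hK hE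
        ((hAmax p hp).trans ((le_abs_self A).trans (le_add_of_nonneg_right hΛ)))
        (fun i => (hSmax p hp i).trans ((le_abs_self S).trans (le_add_of_nonneg_right hsum0))) hs'
      have hlin : ∑ i, v i * ((p.1 * Y i - Λ * Y i) - (p.2 i - μ i))
          = (∑ i, v i * Y i) * p.1 + ∑ i, - v i * p.2 i - ∑ i, v i * (Λ * Y i - μ i) := by
        rw [Finset.sum_mul, ← Finset.sum_add_distrib, ← Finset.sum_sub_distrib]
        exact Finset.sum_congr rfl fun i _ => by ring
      linarith
    · have hlin : (∑ i, v i * Y i) * Λ + ∑ i, - v i * μ i = ∑ i, v i * (Λ * Y i - μ i) := by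
        rw [Finset.sum_mul, ← Finset.sum_add_distrib]
        exact Finset.sum_congr rfl fun i _ => by ring
      linarith
  refine MarkovChain.meanHittingTime_positiveRecurrent_lt_top
    (finite_setOf_sum_le (E / (2 * ε))) (fun x => ?_) x
  have hmem : ∀ s : State n d k, s ∈ {s : State n d k | ∑ i, (s.Q i : ℝ) ≤ E / (2 * ε)} ↔
      2 * ε * ∑ i, (s.Q i : ℝ) ≤ E := fun s => by
    rw [Set.mem_ofPred_eq, le_div_iff₀ (by positivity), mul_comm]
  refine MarkovChain.meanHittingTime_lt_top_of_drift
    (V := fun s => ENNReal.ofReal (lyapunov Λ μ K s + 1)) (E := ENNReal.ofReal E)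
    (fun _ => ENNReal.ofReal_ne_top) ENNReal.ofReal_ne_top (fun s hs => ?_) (fun s hs => ?_) x
  · have := hdrift s
    rw [if_neg ((hmem s).not.1 hs), add_zero] at this
    rw [ENNReal.ofReal_add (hL0 s) zero_le_one, ENNReal.ofReal_one]
    exact add_le_add_left this 1
  · have := hdrift s
    rw [if_pos ((hmem s).1 hs)] at this
    rw [← ENNReal.ofReal_add (add_nonneg (hL0 s) zero_le_one) hE0, add_right_comm,
      ENNReal.ofReal_add (add_nonneg (hL0 s) hE0) zero_le_one, ENNReal.ofReal_one]
    exact add_le_add_left this 1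

end SLQ

namespace SLQ

variable {n d k : ℕ}

/-! ### Instability -/

/-- The work that queues in `I` have or are to receive, compared with the least work they may
receive on average. -/
noncomputable def excess (Λ : ℝ) (I : Finset (Fin n)) (s : State n d k) : ℝ :=
  ((n : ℝ) - d) * (∑ i ∈ I, (s.Q i : ℝ) + Λ * ∑ i ∈ I, (s.rem i : ℝ))
    - Λ * (I.card - d) * ∑ i, (s.rem i : ℝ)

/-- Setting `z i = 1` discards a service that is wasted; `z = 0` is always allowed. At a sampling
the bound rests on `|I \ J| ≥ |I| - d`. -/
theorem le_excess {hd : d < n} {hk : 0 < k} {Λ : ℝ} (hΛ : 0 ≤ Λ) {I : Finset (Fin n)}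
    {s s' : State n d k} {a : ℕ} {σ : Fin n → ℕ} {z : Fin n → ℝ}
    (hz : ∀ i, s.Q i + (a : ℝ) * (if i = s.cur then 1 else 0) - (1 - z i) * σ i
      ≤ (s.nextQ a σ i : ℝ))
    (hs' : s' ∈ (next hd hk s (s.nextQ a σ)).support) :
    excess Λ I s + ((n : ℝ) - d) * (∑ i ∈ I, (((a : ℝ) - Λ) * (if i = s.cur then 1 else 0)
      - (1 - z i) * σ i)) + Λ * (I.card - d) ≤ excess Λ I s' := by
  set Y : Fin n → ℝ := fun i => if i = s.cur then 1 else 0 with hY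
  have hsumY : ∑ i, Y i = 1 := sum_ite_cur s
  have hnd : (0 : ℝ) ≤ n - d := sub_nonneg.2 (Nat.cast_le.2 hd.le)
  obtain ⟨hQ, hcase⟩ := of_mem_support_next hs'
  have hsumQ : ∑ i ∈ I, (s.Q i : ℝ) + ∑ i ∈ I, (((a : ℝ) - Λ) * Y i - (1 - z i) * σ i)
      + Λ * ∑ i ∈ I, Y i ≤ ∑ i ∈ I, (s'.Q i : ℝ) := by
    rw [Finset.mul_sum, ← Finset.sum_add_distrib, ← Finset.sum_add_distrib, hQ]
    exact Finset.sum_le_sum fun i _ => by linarith [hz i]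
  have hmul := mul_le_mul_of_nonneg_left hsumQ hnd
  rcases hcase with hrem | ⟨hrem, J, hJ, hrem'⟩
  · have hr : ∀ i, (s'.rem i : ℝ) = s.rem i - Y i := fun i => by
      rw [← hrem i]
      push_cast
      simp only [hY]
      ring
    simp only [excess, hr, Finset.sum_sub_distrib, hsumY] at hmul ⊢
    linarith
  · have hr : ∀ i, (s.rem i : ℝ) = Y i := fun i => by
      rw [hrem i]
      simp [hY]
    have hr' : ∀ i, (s'.rem i : ℝ) = if i ∈ J.1 then 0 else (k : ℝ) := fun i => by
      rw [hrem' i]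
      push_cast
      rfl
    have hcard : (I.card : ℝ) - d ≤ (I \ J.1).card := by
      have := Finset.le_card_sdiff J.1 I
      rw [J.2] at this
      have : I.card ≤ (I \ J.1).card + d := by omega
      rw [sub_le_iff_le_add]
      exact_mod_cast this
    have h1 := mul_nonneg (mul_nonneg hnd (mul_nonneg hΛ (Nat.cast_nonneg (α := ℝ) k)))
      (sub_nonneg.2 hcard)
    simp only [excess, hr, hr', hsumY, sum_ite_notMem, card_univ_sdiff] at hmul ⊢
    linarith

theorem excess_le {hd : d < n} {hk : 0 < k} {Λ A : ℝ} (hΛ : 0 ≤ Λ) {I : Finset (Fin n)}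
    (hI : d ≤ I.card) {s s' : State n d k} {a : ℕ} {σ : Fin n → ℕ} (ha : (a : ℝ) ≤ A)
    (hs' : s' ∈ (next hd hk s (s.nextQ a σ)).support) :
    excess Λ I s' ≤ excess Λ I s + (((n : ℝ) - d) * (I.card * A + Λ * (I.card * k))
      + Λ * (I.card - d) * (k * n)) := by
  have hnd : (0 : ℝ) ≤ n - d := sub_nonneg.2 (Nat.cast_le.2 hd.le)
  have hId : (0 : ℝ) ≤ I.card - d := sub_nonneg.2 (Nat.cast_le.2 hI)
  have hQ : ∑ i ∈ I, (s'.Q i : ℝ) ≤ ∑ i ∈ I, (s.Q i : ℝ) + I.card * A := by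
    rw [← nsmul_eq_mul, ← Finset.sum_const, ← Finset.sum_add_distrib, (of_mem_support_next hs').1]
    refine Finset.sum_le_sum fun i _ => le_trans ?_ (add_le_add_right ha _)
    have : s.nextQ a σ i ≤ s.Q i + a := by
      unfold State.nextQ
      split_ifs <;> omega
    exact_mod_cast this
  have hr' : ∑ i ∈ I, (s'.rem i : ℝ) ≤ I.card * k := by
    rw [← nsmul_eq_mul]
    exact Finset.sum_le_card_nsmul _ _ _ fun i _ => Nat.cast_le.2 (s'.rem_le i)
  have hr : (0 : ℝ) ≤ ∑ i ∈ I, (s.rem i : ℝ) := Finset.sum_nonneg fun _ _ => Nat.cast_nonneg _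
  have h0 : (0 : ℝ) ≤ ∑ i, (s'.rem i : ℝ) := Finset.sum_nonneg fun _ _ => Nat.cast_nonneg _
  have h1 := mul_le_mul_of_nonneg_left (add_le_add hQ (mul_le_mul_of_nonneg_left hr' hΛ)) hnd
  have h2 := mul_nonneg hnd (mul_nonneg hΛ hr)
  have h3 := mul_le_mul_of_nonneg_left (sum_rem_le s) (mul_nonneg hΛ hId)
  have h4 := mul_nonneg (mul_nonneg hΛ hId) h0
  unfold excess
  linarith

section

variable {hd : d < n} {hk : 0 < k} {ρ : PMF (ℕ × (Fin n → ℕ))} {Λ A S : ℝ} {μ : Fin n → ℝ}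
  {I : Finset (Fin n)}

/-- The mean drift of `excess` is at least the overload of `I` plus the wasted service. The shift
`v` lets the positive part vanish at a chosen state. -/
theorem ofReal_excess_le (hρ : ρ.support.Finite) (hA : mean ρ (fun p => (p.1 : ℝ)) = Λ)
    (hS : ∀ i, mean ρ (fun p => (p.2 i : ℝ)) = μ i) {s : State n d k} {z : Fin n → ℝ}
    (hz : ∀ p ∈ ρ.support, ∀ i, s.Q i + (p.1 : ℝ) * (if i = s.cur then 1 else 0)
      - (1 - z i) * p.2 i ≤ (s.nextQ p.1 p.2 i : ℝ)) (v : ℝ) :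
    ENNReal.ofReal (excess Λ I s - v + (Λ * (I.card - d) - ((n : ℝ) - d) * ∑ i ∈ I, μ i)
      + ((n : ℝ) - d) * ∑ i ∈ I, z i * μ i)
      ≤ ∑' y, step hd hk ρ s y * ENNReal.ofReal (excess Λ I y - v) := by
  have hΛ : 0 ≤ Λ :=
    hA ▸ tsum_nonneg fun p => mul_nonneg ENNReal.toReal_nonneg (Nat.cast_nonneg _)
  set Y : Fin n → ℝ := fun i => if i = s.cur then 1 else 0 with hY
  have hind : ∀ f : Fin n → ℝ, ∑ i, (if i ∈ I then f i else 0) = ∑ i ∈ I, f i := fun f => by simp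
  refine le_trans (ENNReal.ofReal_le_ofReal (le_of_eq ?_)) (le_tsum_step hρ hA hS
    (c := excess Λ I s - v - ((n : ℝ) - d) * (Λ * ∑ i ∈ I, Y i) + Λ * (I.card - d))
    (b := ((n : ℝ) - d) * ∑ i ∈ I, Y i)
    (w := fun i => if i ∈ I then - (((n : ℝ) - d) * (1 - z i)) else 0) ?_)
  · simp only [ite_mul, zero_mul]
    rw [hind]
    have : ∑ i ∈ I, -(((n : ℝ) - d) * (1 - z i)) * μ i
        = ((n : ℝ) - d) * ∑ i ∈ I, z i * μ i - ((n : ℝ) - d) * ∑ i ∈ I, μ i := by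
      simp only [Finset.mul_sum, ← Finset.sum_sub_distrib]
      exact Finset.sum_congr rfl fun i _ => by ring
    rw [this]
    ring
  · intro p hp s' hs'
    have h1 := le_excess hΛ (I := I) (hz p hp) hs'
    simp only [ite_mul, zero_mul]
    rw [hind]
    have : ((n : ℝ) - d) * ∑ i ∈ I, (((p.1 : ℝ) - Λ) * Y i - (1 - z i) * p.2 i)
        = ((n : ℝ) - d) * (∑ i ∈ I, Y i) * p.1 - ((n : ℝ) - d) * (Λ * ∑ i ∈ I, Y i)
          + ∑ i ∈ I, -(((n : ℝ) - d) * (1 - z i)) * (p.2 i : ℝ) := by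
      simp only [Finset.mul_sum, Finset.sum_mul, ← Finset.sum_sub_distrib,
        ← Finset.sum_add_distrib]
      exact Finset.sum_congr rfl fun i _ => by ring
    linarith

theorem le_nextQ (s : State n d k) (a : ℕ) (σ : Fin n → ℕ) (i : Fin n) :
    s.Q i + (a : ℝ) * (if i = s.cur then 1 else 0) - (1 - (0 : Fin n → ℝ) i) * σ i
      ≤ (s.nextQ a σ i : ℝ) := by
  rw [cast_nextQ]
  simp

/-- A state is not positive recurrent if the queues in `I` receive at least as much work as they
can process and, at this state, strictly more than they do process on average. -/
theorem not_positiveRecurrentState (hAmax : ∀ p ∈ ρ.support, (p.1 : ℝ) ≤ A)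
    (hSmax : ∀ p ∈ ρ.support, ∀ i, (p.2 i : ℝ) ≤ S)
    (hA : mean ρ (fun p => (p.1 : ℝ)) = Λ) (hS : ∀ i, mean ρ (fun p => (p.2 i : ℝ)) = μ i)
    (hI : d ≤ I.card) (h : ((n : ℝ) - d) * ∑ i ∈ I, μ i ≤ Λ * (I.card - d))
    {s : State n d k} {z : Fin n → ℝ}
    (hz : ∀ p ∈ ρ.support, ∀ i, s.Q i + (p.1 : ℝ) * (if i = s.cur then 1 else 0)
      - (1 - z i) * p.2 i ≤ (s.nextQ p.1 p.2 i : ℝ))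
    (hpos : 0 < (Λ * (I.card - d) - ((n : ℝ) - d) * ∑ i ∈ I, μ i)
      + ((n : ℝ) - d) * ∑ i ∈ I, z i * μ i) :
    ¬ MarkovChain.PositiveRecurrentState (step hd hk ρ) s := by
  have hρ := finite_support_of_le hAmax hSmax
  have hΛ : 0 ≤ Λ :=
    hA ▸ tsum_nonneg fun p => mul_nonneg ENNReal.toReal_nonneg (Nat.cast_nonneg _)
  refine MarkovChain.not_positiveRecurrentState_of_drift
    (W := fun y => ENNReal.ofReal (excess Λ I y - excess Λ I s))
    (B := ENNReal.ofReal (((n : ℝ) - d) * (I.card * A + Λ * (I.card * k))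
      + Λ * (I.card - d) * (k * n))) ENNReal.ofReal_ne_top (by simp) (fun x => ?_) ?_ ?_
  · refine le_trans (ENNReal.ofReal_le_ofReal ?_) (ofReal_excess_le hρ hA hS
      (z := 0) (fun p _ i => le_nextQ x p.1 p.2 i) (excess Λ I s))
    simp only [Pi.zero_apply, zero_mul, Finset.sum_const_zero, mul_zero, add_zero]
    linarith
  · refine (lt_of_lt_of_le (ENNReal.ofReal_pos.2 ?_)
      (ofReal_excess_le hρ hA hS hz (excess Λ I s))).ne'
    linarith
  · intro x y hy
    rw [step, PMF.mem_support_bind_iff] at hy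
    obtain ⟨p, hp, hy⟩ := hy
    refine le_trans (ENNReal.ofReal_le_ofReal ?_) ENNReal.ofReal_add_le
    linarith [excess_le hΛ hI (hAmax p hp) hy]

end

/-! ### The threshold and the conclusion. -/

theorem lt_threshold_iff (hd : d < n) (μ : Fin n → ℝ) (Λ : ℝ) :
    Λ < threshold hd μ ↔ ∀ I : Finset (Fin n), d + 1 ≤ I.card →
      Λ * (I.card - d) < (n - d) * ∑ i ∈ I, μ i := by
  refine (Finset.lt_inf'_iff _).trans ?_
  simp only [Finset.mem_filter, Finset.mem_univ, true_and]
  refine forall₂_congr fun I hI => ?_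
  have : (0 : ℝ) < I.card - d := sub_pos.2 (Nat.cast_lt.2 hI)
  rw [div_mul_eq_mul_div, lt_div_iff₀ this]

theorem exists_of_threshold_le {hd : d < n} {μ : Fin n → ℝ} {Λ : ℝ} (h : threshold hd μ ≤ Λ) :
    ∃ I : Finset (Fin n), d + 1 ≤ I.card ∧ (n - d) * ∑ i ∈ I, μ i ≤ Λ * (I.card - d) := by
  have := (lt_threshold_iff hd μ Λ).not.1 h.not_gt
  push Not at this
  exact this

theorem exists_of_threshold_lt {hd : d < n} {μ : Fin n → ℝ} {Λ : ℝ} (h : threshold hd μ < Λ) :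
    ∃ I : Finset (Fin n), d + 1 ≤ I.card ∧ (n - d) * ∑ i ∈ I, μ i < Λ * (I.card - d) := by
  obtain ⟨I, hI, h⟩ := (Finset.inf'_lt_iff _).1 h
  replace hI : d + 1 ≤ I.card := (Finset.mem_filter.1 hI).2
  have : (0 : ℝ) < I.card - d := sub_pos.2 (Nat.cast_lt.2 hI)
  rw [div_mul_eq_mul_div, div_lt_iff₀ this] at h
  exact ⟨I, hI, h⟩

/-- From the threshold on, some state with empty queues is not positive recurrent. -/
theorem exists_start_not_positiveRecurrentState {hd : d < n} {hk : 0 < k} (hd1 : 1 ≤ d)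
    {ρ : PMF (ℕ × (Fin n → ℕ))} {Λ A S : ℝ} {μ : Fin n → ℝ}
    (hAmax : ∀ p ∈ ρ.support, (p.1 : ℝ) ≤ A) (hSmax : ∀ p ∈ ρ.support, ∀ i, (p.2 i : ℝ) ≤ S)
    (hA : mean ρ (fun p => (p.1 : ℝ)) = Λ) (hS : ∀ i, mean ρ (fun p => (p.2 i : ℝ)) = μ i)
    (hμ : ∀ i, 0 < μ i) (h : threshold hd μ ≤ Λ) :
    ∃ J, ¬ MarkovChain.PositiveRecurrentState (step hd hk ρ) (start hd hk 0 J) := by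
  obtain ⟨I, hI, hle⟩ := exists_of_threshold_le h
  obtain ⟨i₀, hi₀⟩ : I.Nonempty := Finset.card_pos.1 (by omega)
  -- Here `1 ≤ d` is needed: `i₀ ∈ I` is put into the skipped set, so it is empty, gets no arrivals
  -- and wastes its service in the first slot.
  obtain ⟨J, hJ, -, hJd⟩ := Finset.exists_subsuperset_card_eq
    (Finset.subset_univ {i₀}) (n := d) (by simpa using hd1) (by simpa using hd.le)
  refine ⟨⟨J, hJd⟩, not_positiveRecurrentState hAmax hSmax hA hS (I := I) (by omega) hle
    (z := fun i => if i = i₀ then 1 else 0) (fun p _ i => ?_) ?_⟩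
  · by_cases hi : i = i₀
    · have hne : i₀ ≠ (start hd hk 0 ⟨J, hJd⟩).cur := fun h =>
        (start hd hk 0 ⟨J, hJd⟩).cur_notMem (h ▸ hJ (Finset.mem_singleton_self i₀))
      subst hi
      have hQ : (start hd hk 0 ⟨J, hJd⟩).Q = 0 := rfl
      simp [hne, hQ, -Nat.cast_nonneg]
    · simpa [hi] using le_nextQ (start hd hk 0 ⟨J, hJd⟩) p.1 p.2 i
  · have hnd : (0 : ℝ) < n - d := sub_pos.2 (Nat.cast_lt.2 hd)
    have := mul_pos hnd (hμ i₀)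
    simp only [ite_mul, one_mul, zero_mul, Finset.sum_ite_eq', hi₀, if_true]
    linarith

/-- Below the threshold some positive recurrent state is reachable, and irreducibility spreads the
property. -/
theorem positiveRecurrentOn_iff {hd : d < n} {hk : 0 < k} (hd1 : 1 ≤ d)
    {ρ : PMF (ℕ × (Fin n → ℕ))} {Λ A S : ℝ} {μ : Fin n → ℝ}
    (hAmax : ∀ p ∈ ρ.support, (p.1 : ℝ) ≤ A) (hSmax : ∀ p ∈ ρ.support, ∀ i, (p.2 i : ℝ) ≤ S)
    (hA : mean ρ (fun p => (p.1 : ℝ)) = Λ) (hS : ∀ i, mean ρ (fun p => (p.2 i : ℝ)) = μ i)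
    (hμ : ∀ i, 0 < μ i)
    (hirr : MarkovChain.IrreducibleOn (step hd hk ρ) (stateSpace hd hk ρ)) :
    MarkovChain.PositiveRecurrentOn (step hd hk ρ) (stateSpace hd hk ρ) ↔
      Λ < threshold hd μ := by
  constructor
  · intro hrec
    by_contra hcon
    obtain ⟨J, hJ⟩ := exists_start_not_positiveRecurrentState (hd := hd) (hk := hk) hd1 hAmax
      hSmax hA hS hμ (not_lt.1 hcon)
    exact hJ (hrec _ ⟨_, ⟨J, rfl⟩, .refl⟩)
  · intro hlt x hx
    obtain ⟨y, hy, hxy⟩ := MarkovChain.exists_transGen_of_meanHittingTime_lt_top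
      (meanHittingTime_positiveRecurrent_lt_top (hd := hd) (hk := hk) hAmax hSmax hA hS hμ
        ((lt_threshold_iff hd μ Λ).1 hlt) x)
    have hyC : y ∈ stateSpace hd hk ρ := by
      obtain ⟨e, he, hex⟩ := hx
      exact ⟨e, he, hex.trans hxy.to_reflTransGen⟩
    exact hy.of_leadsTo (hirr y hyC x hx)

end SLQ

theorem theorem1 (n d : ℕ) (hd1 : 1 ≤ d) (hd : d < n)
    (ρ : PMF (ℕ × (Fin n → ℕ))) (lam : ℝ) (μ : Fin n → ℝ) (Amax Smax : ℝ)
    (hAmax : ∀ p ∈ ρ.support, (p.1 : ℝ) ≤ n * Amax)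
    (hSmax : ∀ p ∈ ρ.support, ∀ i, (p.2 i : ℝ) ≤ Smax)
    (hA : SLQ.mean ρ (fun p => (p.1 : ℝ)) = n * lam)
    (hS : ∀ i, SLQ.mean ρ (fun p => (p.2 i : ℝ)) = μ i)
    (hμ : ∀ i, 0 < μ i) :
    -- the irreducible chain is positive recurrent iff the condition holds
    (∀ (k : ℕ) (hk : 0 < k),
      MarkovChain.IrreducibleOn (SLQ.step hd hk ρ) (SLQ.stateSpace hd hk ρ) →
        (MarkovChain.PositiveRecurrentOn (SLQ.step hd hk ρ) (SLQ.stateSpace hd hk ρ) ↔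
          n * lam < SLQ.threshold hd μ)) ∧
    -- without irreducibility: from every state whatsoever, the chain enters the set of
    -- positive recurrent states in finite mean time
    (∀ (k : ℕ) (hk : 0 < k), n * lam < SLQ.threshold hd μ → ∀ x : SLQ.State n d k,
      MarkovChain.meanHittingTime (SLQ.step hd hk ρ)
        {y | MarkovChain.PositiveRecurrentState (SLQ.step hd hk ρ) y} x < ⊤) ∧
    -- without irreducibility: above the threshold no state is positive recurrent
    (∀ (k : ℕ) (hk : 0 < k), SLQ.threshold hd μ < n * lam → ∀ x : SLQ.State n d k,
      ¬ MarkovChain.PositiveRecurrentState (SLQ.step hd hk ρ) x) ∧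
    -- the stability region does not depend on `k`
    (∀ (k k' : ℕ) (hk : 0 < k) (hk' : 0 < k'),
      MarkovChain.IrreducibleOn (SLQ.step hd hk ρ) (SLQ.stateSpace hd hk ρ) →
      MarkovChain.IrreducibleOn (SLQ.step hd hk' ρ) (SLQ.stateSpace hd hk' ρ) →
        (MarkovChain.PositiveRecurrentOn (SLQ.step hd hk ρ) (SLQ.stateSpace hd hk ρ) ↔
          MarkovChain.PositiveRecurrentOn (SLQ.step hd hk' ρ) (SLQ.stateSpace hd hk' ρ))) := by
  refine ⟨fun k hk hirr => SLQ.positiveRecurrentOn_iff hd1 hAmax hSmax hA hS hμ hirr,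
    fun k hk hlt x => SLQ.meanHittingTime_positiveRecurrent_lt_top hAmax hSmax hA hS hμ
      ((SLQ.lt_threshold_iff hd μ _).1 hlt) x,
    fun k hk hlt x => ?_,
    fun k k' hk hk' hirr hirr' =>
      (SLQ.positiveRecurrentOn_iff hd1 hAmax hSmax hA hS hμ hirr).trans
        (SLQ.positiveRecurrentOn_iff hd1 hAmax hSmax hA hS hμ hirr').symm⟩
  -- Strict overload of `I` gives positive drift at every state, without any wasted service.
  obtain ⟨I, hI, h⟩ := SLQ.exists_of_threshold_lt hlt
  refine SLQ.not_positiveRecurrentState hAmax hSmax hA hS (I := I) (by omega) h.le (z := 0)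
    (fun p _ i => SLQ.le_nextQ x p.1 p.2 i) ?_
  simpa using h
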